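/- **Setting.** Let $M,K\ge 1$, $S\ge 1$, $c_m\in\mathbb N$, $0<\mu\le L$, $\alpha_1\ge0$, $\alpha_2>0$, $\delta^2+\alpha_1>0$, $\delta_n>0$, $\eta>0$, $g_0>0$. Let UAV positions $q(k)\in\mathbb R^3$, device positions $w_m\in\mathbb R^3$, transmit amplitudes $b_m(k)\in\mathbb R$ and a matrix $\bar A=(\bar a_m(k))\in\mathbb R^{M\times K}$ be given ($1\le m\le M$, $1\le k\le K$). Put $v_m(k)=\sqrt{g_0}\,\|q(k)-w_m\|^{-1}b_m(k)$. For $A=(a_m(k))\in\mathbb R^{M\times K}$ put $$D_k(A)=\sum_m a_m(k)v_m(k)^2+\tfrac{\delta_n^2}{2},\qquad R_k(A)=\frac{\big(\sum_m a_m(k)v_m(k)\big)^2}{D_k(A)},$$ $$g_k(A)=18S^2+24\Big(\tfrac{M-\sum_m a_m(k)}{M}\Big)^2+18S\sum_{j=\max(1,k-S)}^{k}\Big(\sum_m a_m(j)-R_j(A)\Big).$$ Let $\mathcal D=\{A: D_k(A)>0\ \forall k\}$ be the domain of the quadratic-over-linear terms $R_k$. *Device-selection subproblem.* Over $A\in\mathcal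 D$ and $p,y\in\mathbb R^{2K}$, minimize $$\Theta(A,y)=\log\sum_{k=1}^K e^{y_k+\sum_{k'>k}y_{K+k'}}+\frac1\eta\sum_{m,k}\Big([a_m(k)(1-\bar a_m(k))]^2+[a_m(k)-\bar a_m(k)]^2\Big)$$ subject to 1. $g_k(A)\le\Lambda_k(p)=\min\Big(\frac{2Lp_k-6\delta^2}{\delta^2+\alpha_1},\frac{Lp_{K+k}+\mu-L}{\mu\alpha_2}\Big)$ for all $k$; 2. $p_i\le e^{y_i}$ for all $i$; 3. $\sum_{j=k}^{k+S-1}a_m(j)\ge1$ for all $m$ and $k\le K-S+1$; 4. $\sum_{j=k}^{k+c_m}a_m(j)\le1$ for all $m$ and $k\le K-c_m$. In KKT conditions, constraint 1 counts as the two smooth constraints given by the two arguments of the minimum. *Convexified problem at $(A^t,y^t)$, $A^t\in\mathcal D$.* Minimize $\Theta(A,y)$ over $A\in\mathbb R^{M\times K}$, $p,y\in\mathbb R^{2K}$, $f,d\in\mathbb R^K$ subject to constraints 3 and 4, $f_k\le\Lambda_k(p)$, $p_i\le e^{y_i^t}+e^{y_i^t}(y_i-y_i^t)$, $f_k\ge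 18S^2+\frac{24}{M^2}(M-\sum_m a_m(k))^2+18S\sum_{j=\max(1,k-S)}^{k}(\sum_m a_m(j)-d_j)$ and $d_k\le R_k(A^t)+\nabla R_k(A^t)\cdot(A-A^t)$, for all $k,i$. An *SCA run* is a sequence of points, with selection matrices in $\mathcal D$, each of which after the first is a global solution of the convexified problem at the $(A,y)$ of its predecessor. An *SCA output* is a point $(A,p,y)$ with $A\in\mathcal D$ that either is returned by the convexified problem at $(A,y)$ itself (termination) or is a limit point of the $(A,p,y)$-components of an SCA run. **Statement.** (a) If some matrix satisfies constraints 3 and 4, then the convexified problem has a solution at every $(A^t,y^t)$ with $A^t\in\mathcal D$. (b) Let $A^t\in\mathcal D$. Every solution of the convexified problem at $(A^t,y^t)$ whose selection matrix lies in $\mathcal D$ has an $(A,p,y)$ feasible for the device-selection subproblem; hence its objective value is an upper bound of the optimal value (infimum) of that subproblem. (c) Every SCA output $x=(A,p,y)$ is a KKT point of the device-selection subproblem, and its objective value is an upper bound of the optimal value of that subproblem. It minimizes $\Theta$ over the set of all $(A',p',y')$ admitted by the convexified problem at $(A,y)$, a set to which it belongs. If $x$ lies in the interior of the feasible set of the subproblem,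 or in the interior of the set admitted by the convexified problem at $(A,y)$, then $x$ is a local minimum of the subproblem. (d) For every SCA run whose selection matrices are entrywise nonnegative there is an SCA output $x=(A,p,y)$ such that the objective values of the run converge to that of $x$ and, along a subsequence, the selection matrices converge to $A$ and the components $p_i,y_i$ converge to those of $x$ for every index $i$ such that $y_i$ enters the objective (all $i\ne K+1$). -/

import Mathlib

open Filter Topology

noncomputable section

/-- Karush-Kuhn-Tucker point of the smooth program `min f` subject to `c i ≤ 0` for all `i`, where
`f` and the `c i` are defined on the (open) domain `D`. -/
def IsKKTPoint {E ι : Type*} [NormedAddCommGroup E] [NormedSpace ℝ E] [Fintype ι]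
    (D : Set E) (f : E → ℝ) (c : ι → E → ℝ) (x : E) : Prop :=
  x ∈ D ∧ (∀ i, c i x ≤ 0) ∧
  DifferentiableAt ℝ f x ∧ (∀ i, DifferentiableAt ℝ (c i) x) ∧
  ∃ lam : ι → ℝ, (∀ i, 0 ≤ lam i) ∧ (∀ i, lam i * c i x = 0) ∧
    fderiv ℝ f x + ∑ i, lam i • fderiv ℝ (c i) x = 0

namespace UAVAFL

/-- Data of the device-selection problem with `M` devices and `K` time slots (time slot `k` of the
problem is the element `k - 1` of `Fin K`). The trajectory `q`, the transmit amplitudes `b` and the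
slack matrix `abar` are given. -/
structure Params (M K : ℕ) where
  /-- staleness bound -/
  S : ℕ
  /-- computation times -/
  c : Fin M → ℕ
  /-- strong convexity modulus -/
  mu : ℝ
  /-- Lipschitz constant of the gradient -/
  L : ℝ
  alpha1 : ℝ
  alpha2 : ℝ
  /-- bound on the deviation of the local gradients -/
  delta : ℝ
  /-- noise level; the noise power is its square -/
  deltaN : ℝ
  /-- penalty coefficient -/
  eta : ℝ
  /-- reference channel power gain -/
  g0 : ℝ
  /-- positions of the UAV -/
  q : Fin K → EuclideanSpace ℝ (Fin 3)
  /-- positions of the devices -/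
  w : Fin M → EuclideanSpace ℝ (Fin 3)
  /-- transmit amplitudes -/
  b : Fin M → Fin K → ℝ
  /-- slack copy of the selection matrix -/
  abar : Fin M → Fin K → ℝ
  S_pos : 1 ≤ S
  mu_pos : 0 < mu
  mu_le_L : mu ≤ L
  alpha1_nonneg : 0 ≤ alpha1
  alpha2_pos : 0 < alpha2
  delta_alpha1_pos : 0 < delta ^ 2 + alpha1
  deltaN_pos : 0 < deltaN
  eta_pos : 0 < eta
  g0_pos : 0 < g0

/-- Selection matrices `a m k = a_m(k)`, relaxed to real entries. -/
abbrev Sel (M K : ℕ) : Type := Fin M → Fin K → ℝ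

/-- Vectors of length `2K`: the entry with index `k` is `inl k`, the one with index `K + k` is
`inr k`. -/
abbrev Vec2 (K : ℕ) : Type := Fin K ⊕ Fin K → ℝ

/-- Variables `(A, p, y)` of the device-selection problem. -/
abbrev Var (M K : ℕ) : Type := Sel M K × Vec2 K × Vec2 K

/-- Variables `((A, p, y), f, d)` of the convexified problem. -/
abbrev ConvVar (M K : ℕ) : Type := Var M K × (Fin K → ℝ) × (Fin K → ℝ)

variable {M K : ℕ} (P : Params M K)

/-- Modulus `|h_m(k)|` of the line-of-sight channel. -/
def chanAbs (m : Fin M) (k : Fin K) : ℝ := √P.g0 * ‖P.q k - P.w m‖⁻¹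

/-- The vector `v(k)`, with entries `|h_m(k)| b_m(k)`. -/
def v (k : Fin K) (m : Fin M) : ℝ := chanAbs P m k * P.b m k

/-- The denominator `a(k)ᵀ (v(k) ∘ v(k)) + δ_n² / 2`. -/
def den (A : Sel M K) (k : Fin K) : ℝ := (∑ m, A m k * v P k m ^ 2) + P.deltaN ^ 2 / 2

/-- The quadratic-over-linear term `(∑ₘ a_m(k) |h_m(k)| b_m(k))² / den`. -/
def R (A : Sel M K) (k : Fin K) : ℝ := (∑ m, A m k * v P k m) ^ 2 / den P A k

/-- The domain of the quadratic-over-linear terms: all denominators are positive. -/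
def selDom : Set (Sel M K) := {A | ∀ k, 0 < den P A k}

/-- The slots `k - S, …, k`; slots before the first one contribute nothing. -/
def pastWindow (k : Fin K) : Finset (Fin K) :=
  Finset.univ.filter fun j => (k : ℕ) ≤ j + P.S ∧ j ≤ k

/-- The slots `k, …, k + S - 1`. -/
def staleWindow (k : Fin K) : Finset (Fin K) :=
  Finset.univ.filter fun j => k ≤ j ∧ (j : ℕ) < k + P.S

/-- The slots `k, …, k + c_m`. -/
def activeWindow (m : Fin M) (k : Fin K) : Finset (Fin K) :=
  Finset.univ.filter fun j => k ≤ j ∧ (j : ℕ) ≤ k + P.c m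

/-- The error term `g` in slot `k`, as a function of the selection matrix. -/
def g (A : Sel M K) (k : Fin K) : ℝ :=
  18 * (P.S : ℝ) ^ 2 + 24 * (((M : ℝ) - ∑ m, A m k) / M) ^ 2
    + 18 * P.S * ∑ j ∈ pastWindow P k, ((∑ m, A m j) - R P A j)

/-- First argument of the minimum that defines `Λ(k)`. -/
def Lam1 (p : Vec2 K) (k : Fin K) : ℝ :=
  (2 * P.L * p (.inl k) - 6 * P.delta ^ 2) / (P.delta ^ 2 + P.alpha1)

/-- Second argument of the minimum that defines `Λ(k)`. -/
def Lam2 (p : Vec2 K) (k : Fin K) : ℝ :=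
  (P.L * p (.inr k) + P.mu - P.L) / (P.mu * P.alpha2)

/-- The bound `Λ(k)`. -/
def Lam (p : Vec2 K) (k : Fin K) : ℝ := min (Lam1 P p k) (Lam2 P p k)

/-- The vector `c_k`: its nonzero entries are `1`, at the indices `k` and `K + k'` with `k' > k`. -/
def cvec (k : Fin K) : Vec2 K
  | .inl k' => if k' = k then 1 else 0
  | .inr k' => if k < k' then 1 else 0

/-- The penalty `∑ P(A, Ā)`, over all devices and slots. -/
def penalty (A : Sel M K) : ℝ :=
  ∑ m, ∑ k, ((A m k * (1 - P.abar m k)) ^ 2 + (A m k - P.abar m k) ^ 2)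

/-- The common objective of the device-selection problem and of the convexified problem. -/
def obj (x : Var M K) : ℝ :=
  Real.log (∑ k, Real.exp (∑ i, cvec k i * x.2.2 i)) + 1 / P.eta * penalty P x.1

/-- The staleness constraint. -/
def StaleOK (A : Sel M K) : Prop :=
  ∀ (m : Fin M) (k : Fin K), (k : ℕ) + P.S ≤ K → 1 ≤ ∑ j ∈ staleWindow P k, A m j

/-- The computing-time constraint. -/
def ActiveOK (A : Sel M K) : Prop :=
  ∀ (m : Fin M) (k : Fin K), (k : ℕ) + P.c m < K → ∑ j ∈ activeWindow P m k, A m j ≤ 1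

/-! The device-selection problem. -/

/-- The feasible set of the device-selection problem. -/
def feasible : Set (Var M K) :=
  {x | x.1 ∈ selDom P ∧ (∀ k, g P x.1 k ≤ Lam P x.2.1 k) ∧ StaleOK P x.1 ∧ ActiveOK P x.1 ∧
    ∀ i, x.2.1 i ≤ Real.exp (x.2.2 i)}

/-- The optimal value (infimum) of the device-selection problem. -/
def optVal : EReal := ⨅ x ∈ feasible P, ((obj P x : ℝ) : EReal)

/-- Indices of the inequality constraints of the device-selection problem; the constraint
`g ≤ min (Λ₁, Λ₂)` counts as the two smooth constraints `g ≤ Λ₁` and `g ≤ Λ₂`. -/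
abbrev ConIdx : Type :=
  ((Fin K ⊕ Fin K) ⊕ (Fin K ⊕ Fin K)) ⊕
    ({mk : Fin M × Fin K // (mk.2 : ℕ) + P.S ≤ K} ⊕ {mk : Fin M × Fin K // (mk.2 : ℕ) + P.c mk.1 < K})

/-- The constraint functions of the device-selection problem, in the form `con i x ≤ 0`. -/
def con : ConIdx P → Var M K → ℝ
  | .inl (.inl (.inl k)), x => g P x.1 k - Lam1 P x.2.1 k
  | .inl (.inl (.inr k)), x => g P x.1 k - Lam2 P x.2.1 k
  | .inl (.inr i), x => x.2.1 i - Real.exp (x.2.2 i)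
  | .inr (.inl e), x => 1 - ∑ j ∈ staleWindow P e.1.2, x.1 e.1.1 j
  | .inr (.inr e), x => (∑ j ∈ activeWindow P e.1.1 e.1.2, x.1 e.1.1 j) - 1

/-- The constraint functions describe the feasible set. -/
theorem mem_feasible_iff (x : Var M K) :
    x ∈ feasible P ↔ x.1 ∈ selDom P ∧ ∀ i, con P i x ≤ 0 := by
  constructor
  · rintro ⟨hD, hg, hs, ha, he⟩
    refine ⟨hD, ?_⟩
    rintro (((k | k) | i) | (e | e))
    · exact sub_nonpos.2 ((hg k).trans (min_le_left _ _))
    · exact sub_nonpos.2 ((hg k).trans (min_le_right _ _))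
    · exact sub_nonpos.2 (he i)
    · exact sub_nonpos.2 (hs e.1.1 e.1.2 e.2)
    · exact sub_nonpos.2 (ha e.1.1 e.1.2 e.2)
  · rintro ⟨hD, h⟩
    refine ⟨hD, fun k => le_min ?_ ?_, fun m k hk => ?_, fun m k hk => ?_, fun i => ?_⟩
    · exact sub_nonpos.1 (h (.inl (.inl (.inl k))))
    · exact sub_nonpos.1 (h (.inl (.inl (.inr k))))
    · exact sub_nonpos.1 (h (.inr (.inl ⟨(m, k), hk⟩)))
    · exact sub_nonpos.1 (h (.inr (.inr ⟨(m, k), hk⟩)))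
    · exact sub_nonpos.1 (h (.inl (.inr i)))

/-- KKT points of the device-selection problem. -/
def IsKKT (x : Var M K) : Prop :=
  IsKKTPoint {x : Var M K | x.1 ∈ selDom P} (obj P) (con P) x

/-! The convexified problem at the expansion point `(At, yt)`. -/

/-- The vector `Ω(k)`. -/
def Omega (At : Sel M K) (k : Fin K) (m : Fin M) : ℝ :=
  2 * v P k m * (∑ n, v P k n * At n k) / den P At k ^ 2

/-- The vector `Υ(k)`. -/
def Upsilon (At : Sel M K) (k : Fin K) (m : Fin M) : ℝ := Omega P At k m * den P At k

/-- The vector `Ξ(k)`. -/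
def Xi (At : Sel M K) (k : Fin K) (m : Fin M) : ℝ :=
  -((∑ n, At n k * v P k n) * (∑ n, At n k * v P k n) * v P k m ^ 2 / den P At k ^ 2)

/-- The first-order Taylor surrogate of the quadratic-over-linear term. -/
def Rlin (At A : Sel M K) (k : Fin K) : ℝ :=
  R P At k + ∑ m, (A m k - At m k) * (Upsilon P At k m + Xi P At k m)

/-- The term `Φ(k)`. -/
def Phi (A : Sel M K) (k : Fin K) : ℝ := (M : ℝ) - ∑ m, A m k

/-- The term `Ψ(k)`. -/
def Psi (A : Sel M K) (d : Fin K → ℝ) (k : Fin K) : ℝ :=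
  ∑ j ∈ pastWindow P k, ((∑ m, A m j) - d j)

/-- The feasible set of the convexified problem. -/
def convFeasible (At : Sel M K) (yt : Vec2 K) : Set (ConvVar M K) :=
  {z | (∀ k, z.2.1 k ≤ Lam P z.1.2.1 k) ∧
    (∀ i, z.1.2.1 i ≤ Real.exp (yt i) + Real.exp (yt i) * (z.1.2.2 i - yt i)) ∧
    (∀ k, 18 * (P.S : ℝ) ^ 2 + 24 / (M : ℝ) ^ 2 * Phi z.1.1 k ^ 2
        + 18 * P.S * Psi P z.1.1 z.2.2 k ≤ z.2.1 k) ∧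
    (∀ k, z.2.2 k ≤ Rlin P At z.1.1 k) ∧
    StaleOK P z.1.1 ∧ ActiveOK P z.1.1}

/-- `z` is a (global) solution of the convexified problem at `(At, yt)`. -/
def IsConvSolution (At : Sel M K) (yt : Vec2 K) (z : ConvVar M K) : Prop :=
  z ∈ convFeasible P At yt ∧ IsMinOn (fun z : ConvVar M K => obj P z.1) (convFeasible P At yt) z

/-- The values of `(A, p, y)` that the convexified problem at `(At, yt)` admits. -/
def innerSet (At : Sel M K) (yt : Vec2 K) : Set (Var M K) :=
  {x | ∃ (f d : Fin K → ℝ), (x, f, d) ∈ convFeasible P At yt}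

/-- A run of successive convex approximation: the next iterate solves the convexified problem at
the present one, and the iterates stay in the domain of the surrogates. Only the components `A`
and `y` of the initial point `Z 0` matter. -/
def IsSCARun (Z : ℕ → ConvVar M K) : Prop :=
  (∀ t, (Z t).1.1 ∈ selDom P) ∧
    ∀ t, IsConvSolution P (Z t).1.1 (Z t).1.2.2 (Z (t + 1))

/-- `x` is produced by successive convex approximation: either the method terminates at `x` (the
convexified problem returns its own expansion point), or `x` is a limit point, in the domain, of
some run. -/
def IsSCAOutput (x : Var M K) : Prop :=
  x.1 ∈ selDom P ∧
    ((∃ f d : Fin K → ℝ, IsConvSolution P x.1 x.2.2 (x, f, d)) ∨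
      ∃ Z : ℕ → ConvVar M K, IsSCARun P Z ∧
        ∃ φ : ℕ → ℕ, StrictMono φ ∧ Tendsto (fun j => (Z (φ j)).1) atTop (𝓝 x))

end UAVAFL

end

namespace UAVAFL

variable {M K : ℕ} (P : Params M K)

/-! ### Elementary facts on the surrogate of the quadratic-over-linear term -/

/-! The convexified problem replaces both nonconvex terms by tangents that are exact at the
expansion point: that of num²/den lies below it on the domain (the gap is a square over `den`), that
of exp lies below exp. So admitted points in the domain are feasible, and a feasible point is
admitted at itself. The constraints are monotone in f, d, p and y, so each of these may take its
extreme value (`mem_innerSet_iff`, `reqP`, `reqY`); a continuous function of A alone remains. Its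
penalty grows quadratically while `reqY` has an affine lower bound along the exponents, whence
coercivity and a solution.

The claims on outputs rest on one fixed-point property: x is feasible and minimizes the objective
over `innerSet` at x itself. For a limit of a run, the objective values decrease and hence converge
along the whole run, and the optimality of each step passes to the limit because `reqY` of a fixed
selection is continuous in the expansion point (`IsSCARun.isMinOn`). At a fixed point the surrogate
constraints share values and derivatives with the true ones, and raising p and y strictly decreases
all nonlinear ones; this constraint qualification and Farkas' lemma give the multipliers
(`isKKTPoint_of_surrogate`).

For nonnegative selections Cauchy-Schwarz gives R ≤ ∑ a, so g ≥ 18S², p stays away from 0 and y is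
bounded below; the objective then bounds A and every coordinate that enters it
(`exists_bound_of_obj_le`). -/

theorem L_pos : 0 < P.L := P.mu_pos.trans_le P.mu_le_L

/-- The numerator `∑ₘ a_m(k) v_m(k)` before squaring. -/
noncomputable def num (A : Sel M K) (k : Fin K) : ℝ := ∑ m, A m k * v P k m

theorem R_eq (A : Sel M K) (k : Fin K) : R P A k = num P A k ^ 2 / den P A k := rfl

/-- num²/den is homogeneous of degree one in (num, den), so its tangent has no constant term: it is
2r·num − r²·den, with r the ratio at the expansion point. -/
theorem Rlin_eq {At : Sel M K} (hAt : At ∈ selDom P) (A : Sel M K) (k : Fin K) :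
    Rlin P At A k = 2 * (num P At k / den P At k) * num P A k
      - (num P At k / den P At k) ^ 2 * den P A k := by
  have hD : den P At k ≠ 0 := (hAt k).ne'
  have hcomm : ∑ n, v P k n * At n k = num P At k := Finset.sum_congr rfl fun n _ => mul_comm _ _
  have hterm : ∀ m, (A m k - At m k) * (Upsilon P At k m + Xi P At k m)
      = 2 * (num P At k / den P At k) * (A m k * v P k m - At m k * v P k m)
        - (num P At k / den P At k) ^ 2 * (A m k * v P k m ^ 2 - At m k * v P k m ^ 2) := by
    intro m
    have hnum : ∑ n, At n k * v P k n = num P At k := rfl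
    simp only [Upsilon, Omega, Xi, hcomm, hnum]
    field_simp
    ring
  have h1 : ∑ m, A m k * v P k m = num P A k := rfl
  have h2 : ∑ m, At m k * v P k m = num P At k := rfl
  have h3 : ∑ m, A m k * v P k m ^ 2 = den P A k - P.deltaN ^ 2 / 2 := by simp [den]
  have h4 : ∑ m, At m k * v P k m ^ 2 = den P At k - P.deltaN ^ 2 / 2 := by simp [den]
  rw [Rlin, Finset.sum_congr rfl fun m _ => hterm m, Finset.sum_sub_distrib, ← Finset.mul_sum,
    ← Finset.mul_sum, Finset.sum_sub_distrib, Finset.sum_sub_distrib, h1, h2, h3, h4, R_eq]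
  field_simp
  ring

theorem Rlin_le_R {At A : Sel M K} (hAt : At ∈ selDom P) (hA : A ∈ selDom P) (k : Fin K) :
    Rlin P At A k ≤ R P A k := by
  have hD : den P A k ≠ 0 := (hA k).ne'
  have hDt : den P At k ≠ 0 := (hAt k).ne'
  have h : R P A k - Rlin P At A k
      = (num P A k - num P At k / den P At k * den P A k) ^ 2 / den P A k := by
    rw [Rlin_eq P hAt, R_eq]
    field_simp
    ring
  have := div_nonneg (sq_nonneg (num P A k - num P At k / den P At k * den P A k)) (hA k).le
  linarith

theorem Rlin_self (A : Sel M K) (k : Fin K) : Rlin P A A k = R P A k := by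
  simp [Rlin]

@[fun_prop]
theorem continuous_num (k : Fin K) : Continuous fun A : Sel M K => num P A k := by
  unfold num; fun_prop

@[fun_prop]
theorem continuous_den (k : Fin K) : Continuous fun A : Sel M K => den P A k := by
  unfold den; fun_prop

/-! ### Elimination of the variables `f`, `d`, `p`, `y` -/

/-- The error term with an arbitrary value `r` in place of the quadratic-over-linear terms. -/
noncomputable def errTerm (r : Fin K → ℝ) (A : Sel M K) (k : Fin K) : ℝ :=
  18 * (P.S : ℝ) ^ 2 + 24 * (((M : ℝ) - ∑ m, A m k) / M) ^ 2
    + 18 * P.S * ∑ j ∈ pastWindow P k, ((∑ m, A m j) - r j)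

theorem g_eq (A : Sel M K) : g P A = errTerm P (R P A) A := rfl

theorem errTerm_anti {r r' : Fin K → ℝ} (h : ∀ k, r k ≤ r' k) (A : Sel M K) (k : Fin K) :
    errTerm P r' A k ≤ errTerm P r A k := by
  unfold errTerm
  gcongr
  exact h _

theorem errTerm_eq (r : Fin K → ℝ) (A : Sel M K) (k : Fin K) :
    18 * (P.S : ℝ) ^ 2 + 24 / (M : ℝ) ^ 2 * Phi A k ^ 2 + 18 * P.S * Psi P A r k
      = errTerm P r A k := by
  simp only [errTerm, Phi, Psi, div_pow]
  ring

/-- The smallest `p` for which `γ k ≤ Λ k` in every slot. -/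
noncomputable def reqP (γ : Fin K → ℝ) : Vec2 K
  | .inl k => ((P.delta ^ 2 + P.alpha1) * γ k + 6 * P.delta ^ 2) / (2 * P.L)
  | .inr k => (P.mu * P.alpha2 * γ k + P.L - P.mu) / P.L

theorem le_Lam1_iff (γ : Fin K → ℝ) (p : Vec2 K) (k : Fin K) :
    γ k ≤ Lam1 P p k ↔ reqP P γ (.inl k) ≤ p (.inl k) := by
  rw [Lam1, reqP, le_div_iff₀ P.delta_alpha1_pos, div_le_iff₀ (by have := L_pos P; positivity)]
  constructor <;> intro h <;> linarith

theorem le_Lam2_iff (γ : Fin K → ℝ) (p : Vec2 K) (k : Fin K) :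
    γ k ≤ Lam2 P p k ↔ reqP P γ (.inr k) ≤ p (.inr k) := by
  rw [Lam2, reqP, le_div_iff₀ (mul_pos P.mu_pos P.alpha2_pos), div_le_iff₀ (L_pos P)]
  constructor <;> intro h <;> linarith

theorem le_Lam_iff (γ : Fin K → ℝ) (p : Vec2 K) :
    (∀ k, γ k ≤ Lam P p k) ↔ ∀ i, reqP P γ i ≤ p i := by
  simp only [Lam, le_min_iff, le_Lam1_iff, le_Lam2_iff, Sum.forall, forall_and]

theorem reqP_mono {γ γ' : Fin K → ℝ} (h : ∀ k, γ k ≤ γ' k) (i : Fin K ⊕ Fin K) :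
    reqP P γ i ≤ reqP P γ' i := by
  have := L_pos P
  have h1 := P.delta_alpha1_pos
  have h2 := P.mu_pos
  have h3 := P.alpha2_pos
  rcases i with k | k <;> simp only [reqP] <;> gcongr <;> exact h _

theorem mem_feasible_iff_reqP (x : Var M K) :
    x ∈ feasible P ↔ x.1 ∈ selDom P ∧ StaleOK P x.1 ∧ ActiveOK P x.1 ∧
      (∀ i, reqP P (g P x.1) i ≤ x.2.1 i) ∧ ∀ i, x.2.1 i ≤ Real.exp (x.2.2 i) := by
  rw [← le_Lam_iff]
  simp only [feasible, Set.mem_ofPred_eq]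
  tauto

/-- The surrogate of the error term that the convexified problem uses. -/
noncomputable def gSur (At A : Sel M K) : Fin K → ℝ := errTerm P (Rlin P At A) A

/-- Large d and small f relax the coupling constraints, so the choice d = `Rlin`, f = `gSur` is
admissible whenever any choice is. -/
theorem mem_innerSet_iff (At : Sel M K) (yt : Vec2 K) (x : Var M K) :
    x ∈ innerSet P At yt ↔ StaleOK P x.1 ∧ ActiveOK P x.1 ∧
      (∀ i, reqP P (gSur P At x.1) i ≤ x.2.1 i) ∧
      ∀ i, x.2.1 i ≤ Real.exp (yt i) + Real.exp (yt i) * (x.2.2 i - yt i) := by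
  rw [← le_Lam_iff]
  constructor
  · rintro ⟨f, d, h1, h2, h3, h4, h5, h6⟩
    refine ⟨h5, h6, fun k => ?_, h2⟩
    refine le_trans ?_ (h1 k)
    refine le_trans ?_ (h3 k)
    rw [errTerm_eq]
    exact errTerm_anti P h4 _ _
  · rintro ⟨h5, h6, h1, h2⟩
    refine ⟨gSur P At x.1, Rlin P At x.1, h1, h2, fun k => ?_, fun k => le_rfl, h5, h6⟩
    rw [errTerm_eq]
    rfl

theorem gSur_self (A : Sel M K) : gSur P A A = g P A := by
  rw [gSur, g_eq, funext (Rlin_self P A)]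

theorem g_le_gSur {At A : Sel M K} (hAt : At ∈ selDom P) (hA : A ∈ selDom P) (k : Fin K) :
    g P A k ≤ gSur P At A k :=
  errTerm_anti P (Rlin_le_R P hAt hA) _ _

theorem exp_tangent_le (s t : ℝ) : Real.exp s + Real.exp s * (t - s) ≤ Real.exp t := by
  have h := mul_le_mul_of_nonneg_left (Real.add_one_le_exp (t - s)) (Real.exp_pos s).le
  rw [← Real.exp_add, add_sub_cancel] at h
  linarith

/-- Membership in the domain is a separate hypothesis: the convexified constraints do not enforce
it, and `Rlin` is a lower bound of `R` only there. -/
theorem innerSet_subset_feasible {At : Sel M K} (hAt : At ∈ selDom P) (yt : Vec2 K) {x : Var M K}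
    (hx : x ∈ innerSet P At yt) (hD : x.1 ∈ selDom P) : x ∈ feasible P := by
  obtain ⟨h1, h2, h3, h4⟩ := (mem_innerSet_iff P _ _ _).1 hx
  exact (mem_feasible_iff_reqP P x).2 ⟨hD, h1, h2,
    fun i => (reqP_mono P (g_le_gSur P hAt hD) i).trans (h3 i),
    fun i => (h4 i).trans (exp_tangent_le _ _)⟩

theorem mem_innerSet_self {x : Var M K} (hx : x ∈ feasible P) : x ∈ innerSet P x.1 x.2.2 := by
  obtain ⟨hD, h1, h2, h3, h4⟩ := (mem_feasible_iff_reqP P x).1 hx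
  refine (mem_innerSet_iff P _ _ _).2 ⟨h1, h2, ?_, ?_⟩
  · rwa [gSur_self P]
  · simpa using h4

theorem isConvSolution_iff (At : Sel M K) (yt : Vec2 K) (x : Var M K) :
    (∃ f d, IsConvSolution P At yt (x, f, d)) ↔
      x ∈ innerSet P At yt ∧ IsMinOn (obj P) (innerSet P At yt) x := by
  constructor
  · rintro ⟨f, d, h1, h2⟩
    refine ⟨⟨f, d, h1⟩, ?_⟩
    rintro x' ⟨f', d', h'⟩
    exact isMinOn_iff.1 h2 (x', f', d') h'
  · rintro ⟨⟨f, d, h1⟩, h2⟩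
    exact ⟨f, d, h1, fun z hz => isMinOn_iff.1 h2 z.1 ⟨z.2.1, z.2.2, hz⟩⟩

/-- The smallest `y` that the convexified problem at `(At, yt)` admits with the selection `A`. -/
noncomputable def reqY (At : Sel M K) (yt : Vec2 K) (A : Sel M K) : Vec2 K := fun i =>
  yt i - 1 + Real.exp (-yt i) * reqP P (gSur P At A) i

theorem le_tangent_iff (p s t : ℝ) :
    p ≤ Real.exp s + Real.exp s * (t - s) ↔ s - 1 + Real.exp (-s) * p ≤ t := by
  have hs := Real.exp_pos s
  rw [Real.exp_neg, ← sub_nonneg, ← sub_nonneg (b := s - 1 + _)]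
  have : Real.exp s + Real.exp s * (t - s) - p
      = Real.exp s * (t - (s - 1 + (Real.exp s)⁻¹ * p)) := by
    field_simp
    ring
  rw [this, mul_nonneg_iff_of_pos_left hs]

theorem reqY_le {At : Sel M K} {yt : Vec2 K} {x : Var M K} (hx : x ∈ innerSet P At yt)
    (i : Fin K ⊕ Fin K) : reqY P At yt x.1 i ≤ x.2.2 i := by
  obtain ⟨-, -, h3, h4⟩ := (mem_innerSet_iff P _ _ _).1 hx
  exact (le_tangent_iff _ _ _).1 ((h3 i).trans (h4 i))

/-- The window constraints do not depend on the expansion point, so one selection yields a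
competitor for every step of a run. -/
theorem reqY_mem (At : Sel M K) (yt : Vec2 K) {A : Sel M K} (hs : StaleOK P A)
    (ha : ActiveOK P A) : (A, reqP P (gSur P At A), reqY P At yt A) ∈ innerSet P At yt :=
  (mem_innerSet_iff P _ _ _).2 ⟨hs, ha, fun _ => le_rfl, fun _ => (le_tangent_iff _ _ _).2 le_rfl⟩

/-! ### The objective -/

theorem cvec_nonneg (k : Fin K) (i : Fin K ⊕ Fin K) : 0 ≤ cvec k i := by
  rcases i with j | j <;> simp only [cvec] <;> split_ifs <;> norm_num

theorem cvec_eq_zero_or_one (k : Fin K) (i : Fin K ⊕ Fin K) : cvec k i = 0 ∨ cvec k i = 1 := by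
  rcases i with j | j <;> simp only [cvec] <;> split_ifs <;> simp

/-- The objective as a function of `A` and `y`. -/
noncomputable def objAY (A : Sel M K) (y : Vec2 K) : ℝ :=
  Real.log (∑ k, Real.exp (∑ i, cvec k i * y i)) + 1 / P.eta * penalty P A

theorem sum_exp_pos (hK : 0 < K) (e : Fin K → ℝ) : 0 < ∑ k, Real.exp (e k) :=
  Finset.sum_pos (fun _ _ => Real.exp_pos _) ⟨⟨0, hK⟩, Finset.mem_univ _⟩

theorem objAY_mono (hK : 0 < K) (A : Sel M K) {y y' : Vec2 K} (h : ∀ i, y i ≤ y' i) :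
    objAY P A y ≤ objAY P A y' := by
  unfold objAY
  gcongr with k _ i _
  · exact sum_exp_pos hK _
  · exact cvec_nonneg _ _
  · exact h _

theorem objAY_reqY_le (hK : 0 < K) {At : Sel M K} {yt : Vec2 K} {x : Var M K}
    (hx : x ∈ innerSet P At yt) : objAY P x.1 (reqY P At yt x.1) ≤ obj P x :=
  objAY_mono P hK _ (reqY_le P hx)

theorem le_objAY (A : Sel M K) (y : Vec2 K) (k : Fin K) :
    (∑ i, cvec k i * y i) + 1 / P.eta * penalty P A ≤ objAY P A y := by
  unfold objAY
  gcongr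
  rw [← Real.log_exp (∑ i, cvec k i * y i)]
  refine Real.log_le_log (Real.exp_pos _) ?_
  exact Finset.single_le_sum (f := fun k => Real.exp (∑ i, cvec k i * y i))
    (fun _ _ => (Real.exp_pos _).le) (Finset.mem_univ k)

/-- Quadratic growth in the sup norm, the source of coercivity. -/
theorem norm_sub_sq_le_penalty (A : Sel M K) : ‖A - P.abar‖ ^ 2 ≤ penalty P A := by
  have h0 : ∀ m k, 0 ≤ (A m k * (1 - P.abar m k)) ^ 2 + (A m k - P.abar m k) ^ 2 :=
    fun m k => by positivity
  have hpen : 0 ≤ penalty P A := Finset.sum_nonneg fun m _ => Finset.sum_nonneg fun k _ => h0 m k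
  have hentry : ∀ m k, (A m k - P.abar m k) ^ 2 ≤ penalty P A := by
    intro m k
    calc (A m k - P.abar m k) ^ 2
        ≤ (A m k * (1 - P.abar m k)) ^ 2 + (A m k - P.abar m k) ^ 2 :=
          le_add_of_nonneg_left (sq_nonneg _)
      _ ≤ ∑ k, ((A m k * (1 - P.abar m k)) ^ 2 + (A m k - P.abar m k) ^ 2) :=
          Finset.single_le_sum (fun k _ => h0 m k) (Finset.mem_univ k)
      _ ≤ penalty P A :=
          Finset.single_le_sum
            (f := fun m => ∑ k, ((A m k * (1 - P.abar m k)) ^ 2 + (A m k - P.abar m k) ^ 2))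
            (fun m _ => Finset.sum_nonneg fun k _ => h0 m k) (Finset.mem_univ m)
  have : ‖A - P.abar‖ ≤ √(penalty P A) := by
    refine (pi_norm_le_iff_of_nonneg (Real.sqrt_nonneg _)).2 fun m =>
      (pi_norm_le_iff_of_nonneg (Real.sqrt_nonneg _)).2 fun k => ?_
    exact Real.le_sqrt_of_sq_le (by rw [Real.norm_eq_abs, sq_abs]; exact hentry m k)
  calc ‖A - P.abar‖ ^ 2 ≤ √(penalty P A) ^ 2 := by gcongr
    _ = penalty P A := Real.sq_sqrt hpen

@[fun_prop]
theorem continuous_penalty : Continuous (penalty P) := by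
  unfold penalty; fun_prop

/-- Convergence is asked only of coordinates that enter the objective: the entry K + 1 of y has
coefficient zero in every exponent and may diverge along a run. -/
theorem tendsto_objAY (hK : 0 < K) {ι : Type*} {l : Filter ι} {A : ι → Sel M K}
    {y : ι → Vec2 K} {A₀ : Sel M K} {y₀ : Vec2 K} (hA : Tendsto A l (𝓝 A₀))
    (hy : ∀ i, (∃ k : Fin K, cvec k i ≠ 0) → Tendsto (fun t => y t i) l (𝓝 (y₀ i))) :
    Tendsto (fun t => objAY P (A t) (y t)) l (𝓝 (objAY P A₀ y₀)) := by
  unfold objAY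
  refine Tendsto.add (Tendsto.log (tendsto_finsetSum _ fun k _ => ?_) (sum_exp_pos hK _).ne')
    ((((continuous_penalty P).tendsto A₀).comp hA).const_mul _)
  refine (Real.continuous_exp.tendsto _).comp (tendsto_finsetSum _ fun i _ => ?_)
  by_cases h : cvec k i = 0
  · simpa [h] using tendsto_const_nhds
  · exact (hy i ⟨k, h⟩).const_mul _

/-! ### Continuity of the eliminated constraints -/

theorem tendsto_errTerm {ι : Type*} {l : Filter ι} {r : ι → Fin K → ℝ} {r₀ : Fin K → ℝ}
    {A : ι → Sel M K} {A₀ : Sel M K} (hr : ∀ k, Tendsto (fun t => r t k) l (𝓝 (r₀ k)))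
    (hA : Tendsto A l (𝓝 A₀)) (k : Fin K) :
    Tendsto (fun t => errTerm P (r t) (A t) k) l (𝓝 (errTerm P r₀ A₀ k)) := by
  have hsum : ∀ j, Tendsto (fun t => ∑ m, A t m j) l (𝓝 (∑ m, A₀ m j)) := fun j =>
    tendsto_finsetSum _ fun m _ => tendsto_pi_nhds.1 (tendsto_pi_nhds.1 hA m) j
  unfold errTerm
  exact (((((hsum k).const_sub _).div_const _).pow 2).const_mul _ |>.const_add _).add
    ((tendsto_finsetSum _ fun j _ => (hsum j).sub (hr j)).const_mul _)

theorem continuous_reqP (i : Fin K ⊕ Fin K) : Continuous fun γ : Fin K → ℝ => reqP P γ i := by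
  rcases i with k | k <;> simp only [reqP] <;> fun_prop

theorem tendsto_Rlin {ι : Type*} {l : Filter ι} {At A : ι → Sel M K} {At₀ A₀ : Sel M K}
    (hAt₀ : At₀ ∈ selDom P) (hdom : ∀ t, At t ∈ selDom P) (hAt : Tendsto At l (𝓝 At₀))
    (hA : Tendsto A l (𝓝 A₀)) (k : Fin K) :
    Tendsto (fun t => Rlin P (At t) (A t) k) l (𝓝 (Rlin P At₀ A₀ k)) := by
  simp only [Rlin_eq P hAt₀, fun t => Rlin_eq P (hdom t)]
  have h1 : Tendsto (fun t => num P (At t) k / den P (At t) k) l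
      (𝓝 (num P At₀ k / den P At₀ k)) :=
    (((continuous_num P k).tendsto _).comp hAt).div (((continuous_den P k).tendsto _).comp hAt)
      (hAt₀ k).ne'
  exact ((h1.const_mul 2).mul (((continuous_num P k).tendsto _).comp hA)).sub
    ((h1.pow 2).mul (((continuous_den P k).tendsto _).comp hA))

theorem tendsto_R {ι : Type*} {l : Filter ι} {A : ι → Sel M K} {A₀ : Sel M K}
    (hA₀ : A₀ ∈ selDom P) (hA : Tendsto A l (𝓝 A₀)) (k : Fin K) :
    Tendsto (fun t => R P (A t) k) l (𝓝 (R P A₀ k)) := by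
  simp only [R_eq]
  exact ((((continuous_num P k).tendsto _).comp hA).pow 2).div
    (((continuous_den P k).tendsto _).comp hA) (hA₀ k).ne'

theorem tendsto_reqP_errTerm {ι : Type*} {l : Filter ι} {r : ι → Fin K → ℝ} {r₀ : Fin K → ℝ}
    {A : ι → Sel M K} {A₀ : Sel M K} (hr : ∀ k, Tendsto (fun t => r t k) l (𝓝 (r₀ k)))
    (hA : Tendsto A l (𝓝 A₀)) (i : Fin K ⊕ Fin K) :
    Tendsto (fun t => reqP P (errTerm P (r t) (A t)) i) l (𝓝 (reqP P (errTerm P r₀ A₀) i)) := by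
  have h : Tendsto (fun t => errTerm P (r t) (A t)) l (𝓝 (errTerm P r₀ A₀)) :=
    tendsto_pi_nhds.2 (tendsto_errTerm P hr hA)
  exact Tendsto.comp (g := fun γ => reqP P γ i) ((continuous_reqP P i).tendsto _) h

theorem tendsto_reqY {ι : Type*} {l : Filter ι} {At A : ι → Sel M K} {At₀ A₀ : Sel M K}
    {yt : ι → Vec2 K} {yt₀ : Vec2 K}
    (hAt₀ : At₀ ∈ selDom P) (hdom : ∀ t, At t ∈ selDom P) (hAt : Tendsto At l (𝓝 At₀))
    (hA : Tendsto A l (𝓝 A₀)) {i : Fin K ⊕ Fin K}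
    (hyt : Tendsto (fun t => yt t i) l (𝓝 (yt₀ i))) :
    Tendsto (fun t => reqY P (At t) (yt t) (A t) i) l (𝓝 (reqY P At₀ yt₀ A₀ i)) :=
  (hyt.sub_const 1).add (((Real.continuous_exp.tendsto _).comp hyt.neg).mul
    (tendsto_reqP_errTerm P (tendsto_Rlin P hAt₀ hdom hAt hA) hA i))

theorem isClosed_selOK : IsClosed {A : Sel M K | StaleOK P A ∧ ActiveOK P A} := by
  have h : {A : Sel M K | StaleOK P A ∧ ActiveOK P A} =
      (⋂ (m) (k : Fin K) (_ : (k : ℕ) + P.S ≤ K), {A | 1 ≤ ∑ j ∈ staleWindow P k, A m j}) ∩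
      ⋂ (m) (k : Fin K) (_ : (k : ℕ) + P.c m < K), {A | ∑ j ∈ activeWindow P m k, A m j ≤ 1} := by
    ext A
    simp [StaleOK, ActiveOK]
  rw [h]
  refine IsClosed.inter ?_ ?_ <;> refine isClosed_iInter fun m => isClosed_iInter fun k =>
    isClosed_iInter fun _ => isClosed_le ?_ ?_ <;> fun_prop

/-! ### Solvability of the convexified problem -/

-- With the filter ⊤, big-O is a bound valid for every A, so affine growth can be assembled from
-- sums and multiples.
open Asymptotics in
theorem isBigO_entry (m : Fin M) (k : Fin K) :
    (fun A : Sel M K => A m k) =O[⊤] fun A => 1 + ‖A‖ := by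
  refine IsBigO.of_bound 1 (Eventually.of_forall fun A => ?_)
  rw [one_mul, Real.norm_of_nonneg (by positivity : 0 ≤ 1 + ‖A‖)]
  have := (norm_le_pi_norm (A m) k).trans (norm_le_pi_norm A m)
  linarith

open Asymptotics in
theorem isBigO_const_entry (c : ℝ) : (fun _ : Sel M K => c) =O[⊤] fun A => 1 + ‖A‖ := by
  refine IsBigO.of_bound |c| (Eventually.of_forall fun A => ?_)
  rw [Real.norm_of_nonneg (by positivity : 0 ≤ 1 + ‖A‖), Real.norm_eq_abs]
  nlinarith [abs_nonneg c, norm_nonneg A]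

open Asymptotics in
/-- For a fixed expansion point the smallest admitted values of `y` have an affine lower bound. -/
theorem exists_lower_bound_reqY (At : Sel M K) (yt : Vec2 K) (k : Fin K) :
    ∃ C, ∀ A : Sel M K, -(C * (1 + ‖A‖)) ≤ ∑ i, cvec k i * reqY P At yt A i := by
  -- `gSur` without its nonnegative square; what remains is affine in A.
  let γ : Sel M K → Fin K → ℝ := fun A k =>
    18 * (P.S : ℝ) ^ 2 + 18 * P.S * ∑ j ∈ pastWindow P k, ((∑ m, A m j) - Rlin P At A j)
  have hγ_le : ∀ A k, γ A k ≤ gSur P At A k := fun A k => by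
    have : 0 ≤ 24 * (((M : ℝ) - ∑ m, A m k) / M) ^ 2 := by positivity
    simp only [γ, gSur, errTerm]
    linarith
  have hRlin : ∀ j, (fun A => Rlin P At A j) =O[⊤] fun A : Sel M K => 1 + ‖A‖ := fun j => by
    refine (isBigO_const_entry _).add (IsBigO.fun_sum fun m _ => ?_)
    have := ((isBigO_entry m j).sub (isBigO_const_entry (At m j))).const_mul_left
      (Upsilon P At j m + Xi P At j m)
    simpa only [mul_comm] using this
  have hγ : ∀ k, (fun A => γ A k) =O[⊤] fun A : Sel M K => 1 + ‖A‖ := fun k =>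
    (isBigO_const_entry _).add <| IsBigO.const_mul_left (IsBigO.fun_sum fun j _ =>
      (IsBigO.fun_sum fun m _ => isBigO_entry m j).sub (hRlin j)) _
  have hreq : ∀ i, (fun A => reqP P (γ A) i) =O[⊤] fun A : Sel M K => 1 + ‖A‖ := by
    rintro (k | k)
    · have := (((hγ k).const_mul_left (P.delta ^ 2 + P.alpha1)).add
        (isBigO_const_entry (6 * P.delta ^ 2))).const_mul_left (2 * P.L)⁻¹
      simpa only [reqP, div_eq_inv_mul] using this
    · have := ((((hγ k).const_mul_left (P.mu * P.alpha2)).add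
        (isBigO_const_entry P.L)).sub (isBigO_const_entry P.mu)).const_mul_left P.L⁻¹
      simpa only [reqP, div_eq_inv_mul] using this
  have hsum : (fun A => ∑ i, cvec k i * (yt i - 1 + Real.exp (-yt i) * reqP P (γ A) i))
      =O[⊤] fun A : Sel M K => 1 + ‖A‖ :=
    IsBigO.fun_sum fun i _ => IsBigO.const_mul_left
      ((isBigO_const_entry _).add ((hreq i).const_mul_left _)) _
  obtain ⟨C, hC⟩ := hsum.bound
  refine ⟨C, fun A => ?_⟩
  have h1 := eventually_top.1 hC A
  rw [Real.norm_of_nonneg (by positivity : 0 ≤ 1 + ‖A‖), Real.norm_eq_abs] at h1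
  refine (neg_le_of_abs_le h1).trans (Finset.sum_le_sum fun i _ => ?_)
  refine mul_le_mul_of_nonneg_left ?_ (cvec_nonneg _ _)
  exact add_le_add_right (mul_le_mul_of_nonneg_left (reqP_mono P (hγ_le A) i)
    (Real.exp_pos _).le) _

theorem tendsto_objAY_reqY (hK : 0 < K) (At : Sel M K) (yt : Vec2 K) :
    Tendsto (fun A => objAY P A (reqY P At yt A)) (cocompact _) atTop := by
  obtain ⟨C, hC⟩ := exists_lower_bound_reqY P At yt ⟨0, hK⟩
  have hr : Tendsto (fun A : Sel M K => ‖A - P.abar‖) (cocompact _) atTop := by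
    have := tendsto_norm_cocompact_atTop (E := Sel M K)
    refine tendsto_atTop_mono (f := fun A => ‖A‖ - ‖P.abar‖) (fun A => norm_sub_norm_le _ _) ?_
    simpa only [sub_eq_add_neg] using tendsto_atTop_add_const_right _ (-‖P.abar‖) this
  have hη : 0 < 1 / P.eta := one_div_pos.2 P.eta_pos
  -- With r = ‖A − Ā‖, the penalty contributes r²/η and the exponent at least −|C|(1 + r + ‖Ā‖).
  have hq : Tendsto (fun r : ℝ => r * (1 / P.eta * r - |C|) - |C| * (1 + ‖P.abar‖)) atTop atTop :=
    tendsto_atTop_add_const_right _ _ (tendsto_id.atTop_mul_atTop₀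
      (tendsto_atTop_add_const_right _ _ (tendsto_id.const_mul_atTop hη)))
  refine tendsto_atTop_mono (fun A => ?_) (hq.comp hr)
  refine le_trans ?_ (le_objAY P A _ ⟨0, hK⟩)
  have h1 := hC A
  have h2 := mul_le_mul_of_nonneg_left (norm_sub_sq_le_penalty P A) hη.le
  have h3 : ‖A‖ ≤ ‖A - P.abar‖ + ‖P.abar‖ := by
    simpa using norm_add_le (A - P.abar) P.abar
  have h4 : C * (1 + ‖A‖) ≤ |C| * (1 + (‖A - P.abar‖ + ‖P.abar‖)) := by
    gcongr
    exact le_abs_self C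
  simp only [Function.comp_apply]
  nlinarith

/-- A continuous coercive function of A attains its minimum on the closed set of selections; the
smallest p and y complete the minimizer. -/
theorem exists_isConvSolution (hK : 0 < K) {At : Sel M K} (hAt : At ∈ selDom P) (yt : Vec2 K)
    (hA : ∃ A : Sel M K, StaleOK P A ∧ ActiveOK P A) : ∃ z, IsConvSolution P At yt z := by
  obtain ⟨A₀, hA₀⟩ := hA
  have hcont : Continuous fun A => objAY P A (reqY P At yt A) :=
    continuous_iff_continuousAt.2 fun A => tendsto_objAY P hK tendsto_id fun i _ =>
      tendsto_reqY P hAt (fun _ => hAt) tendsto_const_nhds tendsto_id tendsto_const_nhds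
  obtain ⟨A, hA, hmin⟩ := hcont.continuousOn.exists_isMinOn' (isClosed_selOK P) hA₀
    (((tendsto_objAY_reqY P hK At yt).eventually_ge_atTop _).filter_mono inf_le_left)
  obtain ⟨f, d, h⟩ := (isConvSolution_iff P At yt (A, reqP P (gSur P At A), reqY P At yt A)).2
    ⟨reqY_mem P At yt hA.1 hA.2, fun x hx => by
      obtain ⟨h1, h2, -⟩ := (mem_innerSet_iff P _ _ _).1 hx
      exact (isMinOn_iff.1 hmin _ ⟨h1, h2⟩).trans (objAY_reqY_le P hK hx)⟩
  exact ⟨_, h⟩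

theorem IsConvSolution.mem_feasible {At : Sel M K} {yt : Vec2 K} {z : ConvVar M K}
    (hAt : At ∈ selDom P) (hz : IsConvSolution P At yt z) (hD : z.1.1 ∈ selDom P) :
    z.1 ∈ feasible P :=
  innerSet_subset_feasible P hAt yt ⟨z.2.1, z.2.2, hz.1⟩ hD

theorem optVal_le {x : Var M K} (hx : x ∈ feasible P) : optVal P ≤ ((obj P x : ℝ) : EReal) :=
  iInf₂_le x hx

end UAVAFL

/-! ### Farkas' lemma and KKT points from first-order surrogates -/

/-- **Farkas' lemma** for finitely many linear functionals on a real vector space. -/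
theorem exists_nonneg_combination_of_forall_nonpos {E ι : Type*} [AddCommGroup E] [Module ℝ E]
    (s : Finset ι) (c : ι → E →ₗ[ℝ] ℝ) (f : E →ₗ[ℝ] ℝ)
    (h : ∀ x, (∀ i ∈ s, c i x ≤ 0) → f x ≤ 0) :
    ∃ lam : ι → ℝ, (∀ i, 0 ≤ lam i) ∧ f = ∑ i ∈ s, lam i • c i := by
  classical
  induction s using Finset.induction_on generalizing c f with
  | empty =>
    refine ⟨0, fun _ => le_rfl, LinearMap.ext fun x => ?_⟩
    have h1 := h x (by simp)
    have h2 := h (-x) (by simp)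
    rw [map_neg] at h2
    simp only [Finset.sum_empty, LinearMap.zero_apply]
    linarith
  | insert n s hn ih =>
    -- If the constraint `n` is redundant, its multiplier is 0. Otherwise some `u` violates the
    -- implication for `s` alone, which forces `c n u > 0`.
    by_cases hs : ∀ x, (∀ i ∈ s, c i x ≤ 0) → f x ≤ 0
    · obtain ⟨lam, h0, hf⟩ := ih c f hs
      refine ⟨Function.update lam n 0, fun i => ?_, ?_⟩
      · rcases eq_or_ne i n with rfl | hi <;> simp [*]
      · rw [Finset.sum_insert hn, hf, Function.update_self, zero_smul, zero_add]
        refine Finset.sum_congr rfl fun i hi => ?_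
        rw [Function.update_of_ne (ne_of_mem_of_not_mem hi hn)]
    · push Not at hs
      obtain ⟨u, hu, hfu⟩ := hs
      have hnu : 0 < c n u := by
        by_contra hle
        refine absurd (h u fun i hi => ?_) (not_le.2 hfu)
        rcases Finset.mem_insert.1 hi with rfl | hi
        · exact not_lt.1 hle
        · exact hu i hi
      -- Composing every functional with the projection along `u` onto the kernel of `c n` removes
      -- the constraint `n`.
      obtain ⟨lam, h0, hf⟩ := ih (fun i => c i - (c i u / c n u) • c n) (f - (f u / c n u) • c n)
        (fun x hx => by
          have key := h (x - (c n x / c n u) • u) fun i hi => by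
            rcases Finset.mem_insert.1 hi with rfl | hi
            · simp [div_mul_cancel₀ _ hnu.ne']
            · have := hx i hi
              simp only [LinearMap.sub_apply, LinearMap.smul_apply, smul_eq_mul, map_sub,
                map_smul] at this ⊢
              calc _ = _ := by ring
                _ ≤ 0 := this
          simp only [LinearMap.sub_apply, LinearMap.smul_apply, smul_eq_mul, map_sub,
            map_smul] at key ⊢
          calc _ = _ := by ring
            _ ≤ 0 := key)
      -- The coefficient of `c n` after undoing the projection; it is nonnegative since `f u > 0`
      -- and `c i u ≤ 0` on `s`.
      refine ⟨Function.update lam n (f u / c n u - ∑ i ∈ s, lam i * (c i u / c n u)),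
        fun i => ?_, ?_⟩
      · rcases eq_or_ne i n with rfl | hi
        · rw [Function.update_self, sub_nonneg]
          exact (Finset.sum_nonpos fun i hi => mul_nonpos_of_nonneg_of_nonpos (h0 i)
            (div_nonpos_of_nonpos_of_nonneg (hu i hi) hnu.le)).trans (div_pos hfu hnu).le
        · simp [hi, h0 i]
      · have hsum : ∑ i ∈ s, Function.update lam n
            (f u / c n u - ∑ i ∈ s, lam i * (c i u / c n u)) i • c i = ∑ i ∈ s, lam i • c i :=
          Finset.sum_congr rfl fun i hi => by
            rw [Function.update_of_ne (ne_of_mem_of_not_mem hi hn)]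
        rw [Finset.sum_insert hn, Function.update_self, hsum]
        simp only [smul_sub, Finset.sum_sub_distrib, smul_smul, ← Finset.sum_smul] at hf
        refine (eq_add_of_sub_eq hf).trans ?_
        module

/-- A function that decreases strictly, or starts at a negative value, stays nonpositive for a
short time. -/
theorem eventually_nonpos_of_hasDerivAt {f : ℝ → ℝ} {f' : ℝ} (hf : HasDerivAt f f' 0)
    (h0 : f 0 ≤ 0) (h : f 0 = 0 → f' < 0) : ∀ᶠ s in 𝓝[>] 0, f s ≤ 0 := by
  rcases h0.lt_or_eq with h0 | h0
  · filter_upwards [nhdsWithin_le_nhds (hf.continuousAt.eventually_lt_const h0)] with s hs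
      using hs.le
  · have hslope := (hasDerivAt_iff_tendsto_slope.1 hf).eventually_lt_const (h h0)
    filter_upwards [nhdsWithin_mono 0 (fun s hs => ne_of_gt hs) hslope, self_mem_nhdsWithin]
      with s hs hs0
    rw [slope_def_field, h0, sub_zero, sub_zero] at hs
    by_contra hlt
    exact absurd hs (not_lt.2 (div_nonneg (not_le.1 hlt).le (le_of_lt hs0)))

/-- A point that minimizes the objective subject to surrogate constraints which agree to first
order with the given constraints is a KKT point, provided that some direction strictly decreases
all the constraints in `ι`, while the constraints in `κ` are affine and do not increase along it. -/
theorem isKKTPoint_of_surrogate {E ι κ : Type*} [NormedAddCommGroup E] [NormedSpace ℝ E]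
    [Fintype ι] [Fintype κ] {D : Set E} {f : E → ℝ} {c c' : ι ⊕ κ → E → ℝ} {x : E}
    {f' : E →L[ℝ] ℝ} {l : ι ⊕ κ → E →L[ℝ] ℝ} (hD : x ∈ D)
    (hf : HasFDerivAt f f' x) (hc : ∀ i, HasFDerivAt (c i) (l i) x)
    (hc' : ∀ i, HasFDerivAt (c' i) (l i) x) (heq : ∀ i, c' i x = c i x) (hle : ∀ i, c i x ≤ 0)
    (haff : ∀ j h, c' (.inr j) (x + h) = c' (.inr j) x + l (.inr j) h)
    (hmin : ∀ z, (∀ i, c' i z ≤ 0) → f x ≤ f z)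
    {u : E} (hu : ∀ i, l (.inl i) u < 0) (hu' : ∀ j, l (.inr j) u ≤ 0) :
    IsKKTPoint D f c x := by
  classical
  have hline : ∀ h : E, HasDerivAt (fun s : ℝ => x + s • h) h 0 := fun h => by
    simpa using ((hasDerivAt_id (0 : ℝ)).smul_const h).const_add x
  have hcomp : ∀ {φ : E → ℝ} {φ' : E →L[ℝ] ℝ} (h : E), HasFDerivAt φ φ' x →
      HasDerivAt (fun s : ℝ => φ (x + s • h)) (φ' h) 0 := fun {φ φ'} h hφ =>
    HasFDerivAt.comp_hasDerivAt (f := fun s : ℝ => x + s • h) 0 (by simpa using hφ) (hline h)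
  -- Along such a direction the surrogate constraints hold for a short time, so minimality forbids a
  -- negative derivative of `f`.
  have hstrict : ∀ h : E, (∀ i, c (.inl i) x = 0 → l (.inl i) h < 0) →
      (∀ j, c (.inr j) x = 0 → l (.inr j) h ≤ 0) → 0 ≤ f' h := by
    intro h h1 h2
    have hev : ∀ i, ∀ᶠ s in 𝓝[>] (0 : ℝ), c' i (x + s • h) ≤ 0 := by
      rintro (i | j)
      · refine eventually_nonpos_of_hasDerivAt (hcomp h (hc' _)) ?_ ?_
        · simpa [heq] using hle (.inl i)
        · simpa [heq] using h1 i
      · rcases (hle (.inr j)).lt_or_eq with h0 | h0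
        · refine eventually_nonpos_of_hasDerivAt (hcomp h (hc' _)) ?_ ?_
          · simpa [heq] using h0.le
          · simpa [heq] using fun h' => absurd h' h0.ne
        -- An active affine constraint equals `s * l h` exactly, so a weak inequality suffices.
        · filter_upwards [self_mem_nhdsWithin] with s hs
          rw [haff, heq, h0, zero_add, map_smul, smul_eq_mul]
          exact mul_nonpos_of_nonneg_of_nonpos (le_of_lt hs) (h2 j h0)
    by_contra hneg
    have hslope := (hasDerivAt_iff_tendsto_slope.1 (hcomp h hf)).eventually_lt_const
      (not_le.1 hneg)
    have hslope : ∀ᶠ s in 𝓝[>] (0 : ℝ), slope (fun s => f (x + s • h)) 0 s < 0 :=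
      hslope.filter_mono (nhdsWithin_mono 0 fun s hs => ne_of_gt hs)
    obtain ⟨s, ⟨hs, hs0⟩, hfeas⟩ :=
      ((hslope.and (eventually_mem_nhdsWithin (s := Set.Ioi (0 : ℝ)))).and
        (eventually_all.2 hev)).exists
    rw [slope_def_field] at hs
    have := hmin _ hfeas
    refine absurd hs (not_lt.2 (div_nonneg ?_ ?_))
    · simpa using this
    · simpa using le_of_lt hs0
  -- Adding `ε • u` makes weak inequalities strict on `ι`; then ε → 0.
  have hweak : ∀ h : E, (∀ i, c i x = 0 → l i h ≤ 0) → 0 ≤ f' h := by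
    intro h hh
    have hlim : Tendsto (fun ε : ℝ => f' (h + ε • u)) (𝓝[>] 0) (𝓝 (f' h)) := by
      have : Continuous fun ε : ℝ => f' (h + ε • u) := by fun_prop
      simpa using (this.tendsto 0).mono_left nhdsWithin_le_nhds
    refine ge_of_tendsto hlim ?_
    filter_upwards [self_mem_nhdsWithin] with ε hε
    have hε : 0 < ε := hε
    refine hstrict _ (fun i hi => ?_) (fun j hj => ?_)
    · have := mul_neg_of_pos_of_neg hε (hu i)
      have := hh _ hi
      simp only [map_add, map_smul, smul_eq_mul]
      linarith
    · have := mul_nonpos_of_nonneg_of_nonpos hε.le (hu' j)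
      have := hh _ hj
      simp only [map_add, map_smul, smul_eq_mul]
      linarith
  -- Farkas is applied to the active constraints only; zero multipliers elsewhere give complementary
  -- slackness.
  obtain ⟨lam, h0, hlam⟩ := exists_nonneg_combination_of_forall_nonpos
    (Finset.univ.filter fun i => c i x = 0) (fun i => (l i : E →ₗ[ℝ] ℝ)) (-(f' : E →ₗ[ℝ] ℝ))
    (fun h hh => by
      have := hweak h fun i hi => hh i (by simp [hi])
      simpa using this)
  refine ⟨hD, hle, hf.differentiableAt, fun i => (hc i).differentiableAt,
    fun i => if c i x = 0 then lam i else 0, fun i => ?_, fun i => ?_, ?_⟩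
  · dsimp only
    split_ifs
    exacts [h0 i, le_rfl]
  · dsimp only
    split_ifs with h <;> simp [h]
  · ext h
    have := LinearMap.congr_fun hlam h
    simp only [LinearMap.neg_apply, ContinuousLinearMap.coe_coe, LinearMap.coe_sum,
      Finset.sum_apply, LinearMap.smul_apply, smul_eq_mul] at this
    rw [Finset.sum_filter] at this
    simp only [hf.fderiv, fun i => (hc i).fderiv, add_apply,
      sum_apply, smul_apply, smul_eq_mul, ite_mul,
      zero_mul, zero_apply]
    linarith

/-! ### Fixed points of the convexified problem are KKT points -/

namespace UAVAFL

variable {M K : ℕ} (P : Params M K)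

/-- The constraint functions of the convexified problem at `x`, after elimination of `f`, `d`. -/
noncomputable def conSur (x : Var M K) : ConIdx P → Var M K → ℝ
  | .inl (.inl (.inl k)), z => gSur P x.1 z.1 k - Lam1 P z.2.1 k
  | .inl (.inl (.inr k)), z => gSur P x.1 z.1 k - Lam2 P z.2.1 k
  | .inl (.inr i), z =>
      z.2.1 i - (Real.exp (x.2.2 i) + Real.exp (x.2.2 i) * (z.2.2 i - x.2.2 i))
  | .inr (.inl e), z => 1 - ∑ j ∈ staleWindow P e.1.2, z.1 e.1.1 j
  | .inr (.inr e), z => (∑ j ∈ activeWindow P e.1.1 e.1.2, z.1 e.1.1 j) - 1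

theorem mem_innerSet_of_conSur {x z : Var M K} (h : ∀ i, conSur P x i z ≤ 0) :
    z ∈ innerSet P x.1 x.2.2 := by
  refine (mem_innerSet_iff P _ _ _).2 ⟨fun m k hk => ?_, fun m k hk => ?_, ?_, fun i => ?_⟩
  · exact sub_nonpos.1 (h (.inr (.inl ⟨(m, k), hk⟩)))
  · exact sub_nonpos.1 (h (.inr (.inr ⟨(m, k), hk⟩)))
  · rintro (k | k)
    · exact (le_Lam1_iff P _ _ _).1 (sub_nonpos.1 (h (.inl (.inl (.inl k)))))
    · exact (le_Lam2_iff P _ _ _).1 (sub_nonpos.1 (h (.inl (.inl (.inr k)))))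
  · exact sub_nonpos.1 (h (.inl (.inr i)))

/-- Only the equality of the two derivatives matters below, so their common value stays existential.
-/
theorem exists_hasFDerivAt_R {A : Sel M K} (hA : A ∈ selDom P) (k : Fin K) :
    ∃ l : Sel M K →L[ℝ] ℝ, HasFDerivAt (fun B => R P B k) l A ∧
      HasFDerivAt (fun B => Rlin P A B k) l A := by
  have hn : DifferentiableAt ℝ (fun B : Sel M K => num P B k) A := by unfold num; fun_prop
  have hd : DifferentiableAt ℝ (fun B : Sel M K => den P B k) A := by unfold den; fun_prop
  have hD : den P A k ≠ 0 := (hA k).ne'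
  refine ⟨_, ?_, (hn.hasFDerivAt.const_mul (2 * (num P A k / den P A k))).sub
    (hd.hasFDerivAt.const_mul ((num P A k / den P A k) ^ 2)) |>.congr_of_eventuallyEq
      (Eventually.of_forall fun B => Rlin_eq P hA B k)⟩
  have hdiv := (hn.hasFDerivAt.pow 2).mul ((hasDerivAt_inv hD).comp_hasFDerivAt A hd.hasFDerivAt)
  refine (hdiv.congr_fderiv ?_).congr_of_eventuallyEq
    (Eventually.of_forall fun B => by simp [R_eq, div_eq_mul_inv])
  ext h
  simp
  field_simp
  ring

theorem exists_hasFDerivAt_g {A : Sel M K} (hA : A ∈ selDom P) (k : Fin K) :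
    ∃ l : Sel M K →L[ℝ] ℝ, HasFDerivAt (fun B => g P B k) l A ∧
      HasFDerivAt (fun B => gSur P A B k) l A := by
  choose l h1 h2 using exists_hasFDerivAt_R P hA
  have hq : DifferentiableAt ℝ (fun B : Sel M K => 18 * (P.S : ℝ) ^ 2
      + 24 * (((M : ℝ) - ∑ m, B m k) / M) ^ 2) A := by fun_prop
  have hs : ∀ j, DifferentiableAt ℝ (fun B : Sel M K => ∑ m, B m j) A := fun j => by fun_prop
  exact ⟨_, hq.hasFDerivAt.add ((HasFDerivAt.fun_sum fun j _ =>
      (hs j).hasFDerivAt.sub (h1 j)).const_mul _),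
    hq.hasFDerivAt.add ((HasFDerivAt.fun_sum fun j _ =>
      (hs j).hasFDerivAt.sub (h2 j)).const_mul _)⟩

theorem differentiable_obj (hK : 0 < K) : Differentiable ℝ (obj P) := by
  unfold obj penalty
  refine Differentiable.add (Differentiable.log (by fun_prop) fun x => (sum_exp_pos hK _).ne')
    (by fun_prop)

/-- Raising `p` and `y` strictly decreases the nonlinear constraints. -/
noncomputable def raiseDir (x : Var M K) : Var M K := (0, fun _ => 1, fun i => 2 * Real.exp (-x.2.2 i))

/-- `raiseDir` fixes A, so it leaves the error term and the window constraints unchanged to first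
order and acts only through p and y. -/
theorem exists_hasFDerivAt_con {x : Var M K} (hx : x.1 ∈ selDom P) (i : ConIdx P) :
    ∃ l : Var M K →L[ℝ] ℝ, HasFDerivAt (con P i) l x ∧ HasFDerivAt (conSur P x i) l x ∧
      (∀ j, i = .inl j → l (raiseDir x) < 0) ∧ (∀ j, i = .inr j → l (raiseDir x) ≤ 0 ∧
        ∀ h, conSur P x i (x + h) = conSur P x i x + l h) := by
  let pL : Fin K ⊕ Fin K → Var M K →L[ℝ] ℝ := fun i =>
    (ContinuousLinearMap.proj i).comp ((ContinuousLinearMap.fst ℝ (Vec2 K) (Vec2 K)).comp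
      (ContinuousLinearMap.snd ℝ (Sel M K) (Vec2 K × Vec2 K)))
  let yL : Fin K ⊕ Fin K → Var M K →L[ℝ] ℝ := fun i =>
    (ContinuousLinearMap.proj i).comp ((ContinuousLinearMap.snd ℝ (Vec2 K) (Vec2 K)).comp
      (ContinuousLinearMap.snd ℝ (Sel M K) (Vec2 K × Vec2 K)))
  have hpL : ∀ i z, pL i z = z.2.1 i := fun _ _ => rfl
  have hyL : ∀ i z, yL i z = z.2.2 i := fun _ _ => rfl
  have hp : ∀ i, HasFDerivAt (fun z : Var M K => z.2.1 i) (pL i) x := fun i => (pL i).hasFDerivAt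
  have hy : ∀ i, HasFDerivAt (fun z : Var M K => z.2.2 i) (yL i) x := fun i => (yL i).hasFDerivAt
  have hfst : HasFDerivAt (fun z : Var M K => z.1) (ContinuousLinearMap.fst ℝ _ _) x :=
    hasFDerivAt_fst
  have hLpos := L_pos P
  rcases i with ((k | k) | i) | (e | e)
  · obtain ⟨l, h1, h2⟩ := exists_hasFDerivAt_g P hx k
    have hL := (((hp (.inl k)).const_mul (2 * P.L)).sub_const (6 * P.delta ^ 2)).mul_const
      (P.delta ^ 2 + P.alpha1)⁻¹
    refine ⟨_, (h1.comp x hfst).sub hL, (h2.comp x hfst).sub hL, fun _ _ => ?_, by simp⟩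
    have := mul_pos (inv_pos.2 P.delta_alpha1_pos) hLpos
    simp [raiseDir, hpL]
    linarith
  · obtain ⟨l, h1, h2⟩ := exists_hasFDerivAt_g P hx k
    have hL := (((hp (.inr k)).const_mul P.L).add_const P.mu |>.sub_const P.L).mul_const
      (P.mu * P.alpha2)⁻¹
    refine ⟨_, (h1.comp x hfst).sub hL, (h2.comp x hfst).sub hL, fun _ _ => ?_, by simp⟩
    have := mul_pos (inv_pos.2 (mul_pos P.mu_pos P.alpha2_pos)) hLpos
    simp [raiseDir, hpL] at this ⊢
    linarith
  · refine ⟨_, (hp i).sub (hy i).exp, (hp i).sub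
      ((((hy i).sub_const _).const_mul _).const_add _), fun _ _ => ?_, by simp⟩
    -- The derivative is 1 − exp y · 2 exp (−y) = −1: the factor 2 outweighs the increase of p.
    simp [raiseDir, hpL, hyL, Real.exp_neg]
    field_simp
    norm_num
  · let l : Var M K →L[ℝ] ℝ := -∑ j ∈ staleWindow P e.1.2,
      ((ContinuousLinearMap.proj j : (Fin K → ℝ) →L[ℝ] ℝ).comp
        ((ContinuousLinearMap.proj e.1.1 : Sel M K →L[ℝ] _).comp
          (ContinuousLinearMap.fst ℝ (Sel M K) (Vec2 K × Vec2 K))))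
    have hl : ∀ z : Var M K, l z = -∑ j ∈ staleWindow P e.1.2, z.1 e.1.1 j := fun z => by simp [l]
    have hfun : con P (.inr (.inl e)) = fun z => 1 + l z := funext fun z => by
      rw [hl, con, sub_eq_add_neg]
    have hsur : conSur P x (.inr (.inl e)) = fun z => 1 + l z := hfun
    refine ⟨l, ?_, ?_, by simp, fun _ _ => ⟨by simp [hl, raiseDir], fun h => ?_⟩⟩
    · rw [hfun]; exact l.hasFDerivAt.const_add 1
    · rw [hsur]; exact l.hasFDerivAt.const_add 1
    · simp only [hsur, map_add]; ring
  · let l : Var M K →L[ℝ] ℝ := ∑ j ∈ activeWindow P e.1.1 e.1.2,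
      ((ContinuousLinearMap.proj j : (Fin K → ℝ) →L[ℝ] ℝ).comp
        ((ContinuousLinearMap.proj e.1.1 : Sel M K →L[ℝ] _).comp
          (ContinuousLinearMap.fst ℝ (Sel M K) (Vec2 K × Vec2 K))))
    have hl : ∀ z : Var M K, l z = ∑ j ∈ activeWindow P e.1.1 e.1.2, z.1 e.1.1 j :=
      fun z => by simp [l]
    have hfun : con P (.inr (.inr e)) = fun z => l z - 1 := funext fun z => by
      rw [hl, con]
    have hsur : conSur P x (.inr (.inr e)) = fun z => l z - 1 := hfun
    refine ⟨l, ?_, ?_, by simp, fun _ _ => ⟨by simp [hl, raiseDir], fun h => ?_⟩⟩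
    · rw [hfun]; exact l.hasFDerivAt.sub_const 1
    · rw [hsur]; exact l.hasFDerivAt.sub_const 1
    · simp only [hsur, map_add]; ring

theorem conSur_self (x : Var M K) (i : ConIdx P) :
    conSur P x i x = con P i x := by
  rcases i with ((k | k) | i) | (e | e) <;> simp [conSur, con, gSur_self P x.1]

/-- A feasible fixed point of the convexified problem is a KKT point. -/
theorem isKKT_of_isMinOn (hK : 0 < K) {x : Var M K} (hx : x ∈ feasible P)
    (hmin : IsMinOn (obj P) (innerSet P x.1 x.2.2) x) : IsKKT P x := by
  obtain ⟨hD, hle⟩ := (mem_feasible_iff P x).1 hx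
  choose l h1 h2 h3 h4 using exists_hasFDerivAt_con P hD
  exact isKKTPoint_of_surrogate hD (differentiable_obj P hK x).hasFDerivAt h1 h2
    (conSur_self P x) hle (fun j => (h4 _ j rfl).2)
    (fun z hz => hmin (mem_innerSet_of_conSur P hz)) (fun j => h3 _ j rfl)
    (fun j => (h4 _ j rfl).1)

/-! ### Runs of successive convex approximation -/

variable {P} in
-- The initial point need not be feasible, hence the shift by one here and in the descent property.
theorem IsSCARun.mem_feasible {Z : ℕ → ConvVar M K} (hZ : IsSCARun P Z) (t : ℕ) :
    (Z (t + 1)).1 ∈ feasible P :=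
  (hZ.2 t).mem_feasible P (hZ.1 t) (hZ.1 (t + 1))

variable {P} in
-- A feasible iterate competes in the convexified problem at itself, so its successor is no worse.
theorem IsSCARun.antitone {Z : ℕ → ConvVar M K} (hZ : IsSCARun P Z) :
    Antitone fun t => obj P (Z (t + 1)).1 :=
  antitone_nat_of_succ_le fun t => by
    obtain ⟨-, h⟩ := (isConvSolution_iff P _ _ _).1 ⟨_, _, hZ.2 (t + 1)⟩
    exact isMinOn_iff.1 h _ (mem_innerSet_self P (hZ.mem_feasible t))

variable {P} in
/-- Along a subsequence on which the selections and the coordinates of `y` that enter the objective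
converge, the objective values of the run converge to the value of the limit. -/
theorem IsSCARun.tendsto_obj (hK : 0 < K) {Z : ℕ → ConvVar M K} (hZ : IsSCARun P Z) {x : Var M K}
    {φ : ℕ → ℕ} (hφ : StrictMono φ) (hA : Tendsto (fun j => (Z (φ j)).1.1) atTop (𝓝 x.1))
    (hy : ∀ i, (∃ k : Fin K, cvec k i ≠ 0) →
      Tendsto (fun j => (Z (φ j)).1.2.2 i) atTop (𝓝 (x.2.2 i))) :
    Tendsto (fun t => obj P (Z t).1) atTop (𝓝 (obj P x)) := by
  have hsub : Tendsto (fun j => obj P (Z (φ j)).1) atTop (𝓝 (obj P x)) :=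
    tendsto_objAY P hK hA hy
  -- Descent holds only from index 1 on; `φ (j + 1) ≥ 1` makes the natural subtraction exact.
  have hφ1 : Tendsto (fun j => φ (j + 1) - 1) atTop atTop :=
    (tendsto_sub_atTop_nat 1).comp (hφ.tendsto_atTop.comp (tendsto_add_atTop_nat 1))
  refine (tendsto_add_atTop_iff_nat 1).1 ?_
  refine (tendsto_iff_tendsto_subseq_of_antitone hZ.antitone hφ1).2 ?_
  refine ((tendsto_add_atTop_iff_nat 1).2 hsub).congr fun j => ?_
  have : 1 ≤ φ (j + 1) := (Nat.succ_le_succ (Nat.zero_le j)).trans (hφ.id_le (j + 1))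
  simp only [Function.comp_apply, Nat.sub_add_cancel this]

variable {P} in
/-- Such a limit minimizes the objective over the set admitted by the convexified problem at it. -/
theorem IsSCARun.isMinOn (hK : 0 < K) {Z : ℕ → ConvVar M K} (hZ : IsSCARun P Z) {x : Var M K}
    (hx : x.1 ∈ selDom P)
    {φ : ℕ → ℕ} (hφ : StrictMono φ) (hA : Tendsto (fun j => (Z (φ j)).1.1) atTop (𝓝 x.1))
    (hy : ∀ i, (∃ k : Fin K, cvec k i ≠ 0) →
      Tendsto (fun j => (Z (φ j)).1.2.2 i) atTop (𝓝 (x.2.2 i))) :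
    IsMinOn (obj P) (innerSet P x.1 x.2.2) x := by
  refine isMinOn_iff.2 fun x' hx' => ?_
  refine le_trans ?_ (objAY_reqY_le P hK hx')
  have hlim : Tendsto (fun j => objAY P x'.1 (reqY P (Z (φ j)).1.1 (Z (φ j)).1.2.2 x'.1)) atTop
      (𝓝 (objAY P x'.1 (reqY P x.1 x.2.2 x'.1))) :=
    tendsto_objAY P hK tendsto_const_nhds fun i hi =>
      tendsto_reqY P hx (fun j => hZ.1 _) hA tendsto_const_nhds (hy i hi)
  -- The successors of the subsequence need not converge; their objective values do.
  have hobj : Tendsto (fun j => obj P (Z (φ j + 1)).1) atTop (𝓝 (obj P x)) :=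
    Tendsto.comp (g := fun t => obj P (Z t).1) (f := fun j => φ j + 1)
      (hZ.tendsto_obj hK hφ hA hy) (tendsto_atTop_mono (fun j => Nat.le_succ (φ j)) hφ.tendsto_atTop)
  refine le_of_tendsto_of_tendsto' hobj hlim fun j => ?_
  obtain ⟨-, h⟩ := (isConvSolution_iff P _ _ _).1 ⟨_, _, hZ.2 (φ j)⟩
  obtain ⟨h1, h2, -⟩ := (mem_innerSet_iff P _ _ _).1 hx'
  have h3 := isMinOn_iff.1 h _ (reqY_mem P _ _ h1 h2)
  exact h3

theorem tendsto_reqP_g {ι : Type*} {l : Filter ι} {A : ι → Sel M K} {A₀ : Sel M K}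
    (hA₀ : A₀ ∈ selDom P) (hA : Tendsto A l (𝓝 A₀)) (i : Fin K ⊕ Fin K) :
    Tendsto (fun t => reqP P (g P (A t)) i) l (𝓝 (reqP P (g P A₀) i)) :=
  tendsto_reqP_errTerm P (tendsto_R P hA₀ hA) hA i

theorem mem_feasible_of_tendsto {Z : ℕ → Var M K} {x : Var M K} (hZ : ∀ t, Z t ∈ feasible P)
    (hx : x.1 ∈ selDom P) (h : Tendsto Z atTop (𝓝 x)) : x ∈ feasible P := by
  have hA : Tendsto (fun t => (Z t).1) atTop (𝓝 x.1) := (continuous_fst.tendsto _).comp h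
  have hp : ∀ i, Tendsto (fun t => (Z t).2.1 i) atTop (𝓝 (x.2.1 i)) := fun i =>
    ((by fun_prop : Continuous fun z : Var M K => z.2.1 i).tendsto x).comp h
  have hy : ∀ i, Tendsto (fun t => (Z t).2.2 i) atTop (𝓝 (x.2.2 i)) := fun i =>
    ((by fun_prop : Continuous fun z : Var M K => z.2.2 i).tendsto x).comp h
  have hmem := fun t => (mem_feasible_iff_reqP P (Z t)).1 (hZ t)
  have hsel := (isClosed_selOK P).mem_of_tendsto hA
    (Eventually.of_forall fun t => ⟨(hmem t).2.1, (hmem t).2.2.1⟩)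
  exact (mem_feasible_iff_reqP P x).2 ⟨hx, hsel.1, hsel.2,
    fun i => le_of_tendsto_of_tendsto' (tendsto_reqP_g P hx hA i) (hp i)
      fun t => (hmem t).2.2.2.1 i,
    fun i => le_of_tendsto_of_tendsto' (hp i) ((Real.continuous_exp.tendsto _).comp (hy i))
      fun t => (hmem t).2.2.2.2 i⟩

variable {P} in
theorem IsSCAOutput.feasible_and_isMinOn (hK : 0 < K) {x : Var M K} (hx : IsSCAOutput P x) :
    x ∈ feasible P ∧ IsMinOn (obj P) (innerSet P x.1 x.2.2) x := by
  obtain ⟨hD, h | ⟨Z, hZ, φ, hφ, hlim⟩⟩ := hx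
  · obtain ⟨h1, h2⟩ := (isConvSolution_iff P _ _ _).1 h
    exact ⟨innerSet_subset_feasible P hD _ h1 hD, h2⟩
  · refine ⟨?_, hZ.isMinOn hK hD hφ ((continuous_fst.tendsto _).comp hlim) fun i _ =>
      ((by fun_prop : Continuous fun z : Var M K => z.2.2 i).tendsto x).comp hlim⟩
    refine mem_feasible_of_tendsto P (Z := fun j => (Z (φ (j + 1))).1) (fun j => ?_) hD
      ((tendsto_add_atTop_iff_nat 1).2 hlim)
    have h1 : 1 ≤ φ (j + 1) := (Nat.succ_le_succ (Nat.zero_le j)).trans (hφ.id_le (j + 1))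
    have := hZ.mem_feasible (φ (j + 1) - 1)
    rwa [Nat.sub_add_cancel h1] at this

/-! ### Interior points -/

theorem objAY_lt_of_update (A : Sel M K) (y : Vec2 K) (k : Fin K) {s : ℝ} (hs : s < y (.inl k)) :
    objAY P A (Function.update y (.inl k) s) < objAY P A y := by
  have hle : ∀ i, Function.update y (.inl k) s i ≤ y i := fun i => by
    rcases eq_or_ne i (.inl k) with rfl | hi <;> simp [*, le_of_lt]
  have hK : 0 < K := k.pos
  unfold objAY
  gcongr 1
  refine Real.log_lt_log (sum_exp_pos hK _) (Finset.sum_lt_sum (fun k' _ => ?_)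
    ⟨k, Finset.mem_univ _, Real.exp_lt_exp.2 (Finset.sum_lt_sum (fun i _ => ?_)
      ⟨.inl k, Finset.mem_univ _, ?_⟩)⟩)
  · gcongr with i
    exacts [cvec_nonneg _ _, hle i]
  · exact mul_le_mul_of_nonneg_left (hle i) (cvec_nonneg _ _)
  · simpa [cvec] using hs

/-- A minimizer over the set admitted at itself attains `p ≤ exp y` with equality in the
coordinates with index `k`. -/
theorem exp_le_of_isMinOn {x : Var M K} (hx : x ∈ feasible P)
    (hmin : IsMinOn (obj P) (innerSet P x.1 x.2.2) x) (k : Fin K) :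
    Real.exp (x.2.2 (.inl k)) ≤ x.2.1 (.inl k) := by
  by_contra! hlt
  obtain ⟨h1, h2, h3, h4⟩ := (mem_innerSet_iff P _ _ _).1 (mem_innerSet_self P hx)
  -- The smallest value of this coordinate that the tangent constraint allows for the given p.
  set s := x.2.2 (.inl k) - 1 + Real.exp (-x.2.2 (.inl k)) * x.2.1 (.inl k) with hs
  have hslt : s < x.2.2 (.inl k) := by
    have : Real.exp (-x.2.2 (.inl k)) * x.2.1 (.inl k) < 1 := by
      rw [Real.exp_neg, inv_mul_lt_iff₀ (Real.exp_pos _), mul_one]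
      exact hlt
    linarith
  refine absurd (isMinOn_iff.1 hmin (x.1, x.2.1, Function.update x.2.2 (.inl k) s) ?_)
    (not_le.2 (objAY_lt_of_update P x.1 x.2.2 k hslt))
  refine (mem_innerSet_iff P _ _ _).2 ⟨h1, h2, h3, fun i => ?_⟩
  rcases eq_or_ne i (.inl k) with rfl | hi
  · simp only [Function.update_self]
    exact (le_tangent_iff _ _ _).2 le_rfl
  · simp only [Function.update_of_ne hi]
    exact h4 i

/-- An interior point stays feasible when all of p is raised slightly. -/
theorem lt_exp_of_mem_interior {x : Var M K} (hx : x ∈ interior (feasible P))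
    (i : Fin K ⊕ Fin K) : x.2.1 i < Real.exp (x.2.2 i) := by
  have hcont : Tendsto (fun s : ℝ => ((x.1, x.2.1 + s • (1 : Vec2 K), x.2.2) : Var M K)) (𝓝 0)
      (𝓝 x) := by
    have : Continuous fun s : ℝ => ((x.1, x.2.1 + s • (1 : Vec2 K), x.2.2) : Var M K) := by
      fun_prop
    simpa using this.tendsto 0
  have hev := (hcont.eventually (mem_interior_iff_mem_nhds.1 hx)).filter_mono
    (nhdsWithin_le_nhds (s := Set.Ioi 0))
  obtain ⟨s, hs, hs0⟩ := (hev.and self_mem_nhdsWithin).exists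
  have h := ((mem_feasible_iff_reqP P _).1 hs).2.2.2.2 i
  have hs0 : 0 < s := hs0
  simp at h
  linarith

/-- The first alternative is void: the minimizer has p = exp y in an objective coordinate, which an
interior point of the feasible set excludes. -/
theorem isLocalMinOn_of_mem_interior (hK : 0 < K) {x : Var M K} (hx : x ∈ feasible P)
    (hmin : IsMinOn (obj P) (innerSet P x.1 x.2.2) x)
    (hint : x ∈ interior (feasible P) ∨ x ∈ interior (innerSet P x.1 x.2.2)) :
    IsLocalMinOn (obj P) (feasible P) x := by
  rcases hint with h | h
  · exact absurd (exp_le_of_isMinOn P hx hmin ⟨0, hK⟩) (not_le.2 (lt_exp_of_mem_interior P h _))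
  · exact (hmin.isLocalMin (mem_interior_iff_mem_nhds.1 h)).on _

/-! ### Compactness of runs with nonnegative selections -/

theorem half_noise_le_den {A : Sel M K} (hA : ∀ m k, 0 ≤ A m k) (k : Fin K) :
    P.deltaN ^ 2 / 2 ≤ den P A k :=
  le_add_of_nonneg_left (Finset.sum_nonneg fun m _ => mul_nonneg (hA m k) (sq_nonneg _))

theorem mem_selDom_of_nonneg {A : Sel M K} (hA : ∀ m k, 0 ≤ A m k) : A ∈ selDom P := fun k =>
  (half_pos (pow_pos P.deltaN_pos 2)).trans_le (half_noise_le_den P hA k)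

/-- Cauchy-Schwarz with weights a_m: (∑ a v)² ≤ (∑ a)(∑ a v²), and the noise only enlarges `den`. -/
theorem R_le_sum {A : Sel M K} (hA : ∀ m k, 0 ≤ A m k) (k : Fin K) : R P A k ≤ ∑ m, A m k := by
  rw [R_eq, div_le_iff₀ (mem_selDom_of_nonneg P hA k)]
  have hcs : num P A k ^ 2 ≤ (∑ m, A m k) * ∑ m, A m k * v P k m ^ 2 :=
    Finset.sum_sq_le_sum_mul_sum_of_sq_le_mul _ (fun m _ => hA m k)
      (fun m _ => mul_nonneg (hA m k) (sq_nonneg _)) fun m _ => by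
      rw [mul_pow, sq (A m k), mul_assoc]
  refine hcs.trans (mul_le_mul_of_nonneg_left ?_ (Finset.sum_nonneg fun m _ => hA m k))
  exact le_add_of_nonneg_right (by positivity)

theorem le_g_of_nonneg {A : Sel M K} (hA : ∀ m k, 0 ≤ A m k) (k : Fin K) :
    18 * (P.S : ℝ) ^ 2 ≤ g P A k := by
  have h1 : 0 ≤ 24 * (((M : ℝ) - ∑ m, A m k) / M) ^ 2 := by positivity
  have h2 : 0 ≤ 18 * (P.S : ℝ) * ∑ j ∈ pastWindow P k, ((∑ m, A m j) - R P A j) :=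
    mul_nonneg (by positivity) (Finset.sum_nonneg fun j _ => sub_nonneg.2 (R_le_sum P hA j))
  unfold g
  linarith

theorem reqP_pos {c : ℝ} (hc : 0 < c) (i : Fin K ⊕ Fin K) : 0 < reqP P (fun _ => c) i := by
  have hL := L_pos P
  rcases i with k | k
  · have := mul_pos P.delta_alpha1_pos hc
    exact div_pos (by positivity) (by positivity)
  · have := mul_pos (mul_pos P.mu_pos P.alpha2_pos) hc
    have := P.mu_le_L
    exact div_pos (by linarith) hL

/-- Feasible points with nonnegative selections have `y` bounded below. -/
theorem exists_lower_bound_y : ∃ B, 0 ≤ B ∧ ∀ x ∈ feasible P, (∀ m k, 0 ≤ x.1 m k) →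
    ∀ i, 0 < x.2.1 i ∧ -B ≤ x.2.2 i := by
  have hS : (0 : ℝ) < 18 * (P.S : ℝ) ^ 2 := by
    have : 0 < (P.S : ℝ) := Nat.cast_pos.2 P.S_pos
    positivity
  let ρ : Vec2 K := reqP P fun _ => 18 * (P.S : ℝ) ^ 2
  refine ⟨∑ i, |Real.log (ρ i)|, Finset.sum_nonneg fun _ _ => abs_nonneg _,
    fun x hx hA i => ?_⟩
  obtain ⟨-, -, -, h1, h2⟩ := (mem_feasible_iff_reqP P x).1 hx
  have hρ : 0 < ρ i := reqP_pos P hS i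
  have hρp : ρ i ≤ x.2.1 i := (reqP_mono P (le_g_of_nonneg P hA) i).trans (h1 i)
  refine ⟨hρ.trans_le hρp, ?_⟩
  have hlog : Real.log (ρ i) ≤ x.2.2 i :=
    (Real.log_le_iff_le_exp hρ).2 (hρp.trans (h2 i))
  have hsum : |Real.log (ρ i)| ≤ ∑ i, |Real.log (ρ i)| :=
    Finset.single_le_sum (f := fun i => |Real.log (ρ i)|) (fun _ _ => abs_nonneg _)
      (Finset.mem_univ i)
  linarith [neg_abs_le (Real.log (ρ i))]

/-- The feasible points with nonnegative selections and bounded objective are bounded in `A` and in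
all the coordinates that enter the objective. -/
theorem exists_bound_of_obj_le (hK : 0 < K) (C : ℝ) : ∃ B, ∀ x ∈ feasible P,
    (∀ m k, 0 ≤ x.1 m k) → obj P x ≤ C → ‖x.1‖ ≤ B ∧
      ∀ i, (∃ k : Fin K, cvec k i ≠ 0) → |x.2.1 i| ≤ B ∧ |x.2.2 i| ≤ B := by
  obtain ⟨B₀, hB₀, hlow⟩ := exists_lower_bound_y P
  have hη : 0 < 1 / P.eta := one_div_pos.2 P.eta_pos
  let N : ℝ := ∑ _i : Fin K ⊕ Fin K, B₀
  have hB₀N : 0 ≤ N := Finset.sum_nonneg fun _ _ => hB₀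
  let Y : ℝ := |C| + N + B₀
  -- The penalty gives ‖A − Ā‖² ≤ t with t = η(|C| + N), and r² ≤ t implies r ≤ 1 + t.
  let X : ℝ := ‖P.abar‖ + (1 + P.eta * (|C| + N))
  refine ⟨max X (max Y (Real.exp Y)), fun x hx hA hC => ?_⟩
  have hy := fun i => (hlow x hx hA i).2
  have hpen : 0 ≤ 1 / P.eta * penalty P x.1 :=
    mul_nonneg hη.le ((sq_nonneg _).trans (norm_sub_sq_le_penalty P x.1))
  have hterm : ∀ (k : Fin K) i, -B₀ ≤ cvec k i * x.2.2 i := fun k i => by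
    rcases cvec_eq_zero_or_one k i with h | h <;> rw [h]
    · linarith
    · linarith [hy i]
  have hsum : ∀ k : Fin K, -N ≤ ∑ i, cvec k i * x.2.2 i := fun k => by
    simp only [N, ← Finset.sum_neg_distrib]
    exact Finset.sum_le_sum fun i _ => hterm k i
  have hle : ∀ k : Fin K, (∑ i, cvec k i * x.2.2 i) + 1 / P.eta * penalty P x.1 ≤ |C| := fun k =>
    (le_objAY P x.1 x.2.2 k).trans (hC.trans (le_abs_self C))
  refine ⟨le_trans ?_ (le_max_left _ _), ?_⟩
  · have h1 : 1 / P.eta * ‖x.1 - P.abar‖ ^ 2 ≤ |C| + N := by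
      have := mul_le_mul_of_nonneg_left (norm_sub_sq_le_penalty P x.1) hη.le
      linarith [hsum ⟨0, hK⟩, hle ⟨0, hK⟩]
    have h2 : ‖x.1 - P.abar‖ ^ 2 ≤ P.eta * (|C| + N) := by
      rwa [one_div, inv_mul_le_iff₀ P.eta_pos] at h1
    have h3 : ‖x.1 - P.abar‖ ≤ 1 + P.eta * (|C| + N) := by
      nlinarith [sq_nonneg (‖x.1 - P.abar‖ - 1), norm_nonneg (x.1 - P.abar)]
    have h4 : ‖x.1‖ ≤ ‖x.1 - P.abar‖ + ‖P.abar‖ := by simpa using norm_add_le (x.1 - P.abar) P.abar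
    simp only [X]
    linarith
  · rintro i ⟨k, hk⟩
    -- In an exponent that contains `y i`, the other terms total at least −N.
    have hyi : x.2.2 i ≤ |C| + N := by
      have h1 : cvec k i * x.2.2 i + ∑ i' ∈ Finset.univ.erase i, -B₀
          ≤ ∑ i', cvec k i' * x.2.2 i' := by
        rw [← Finset.add_sum_erase _ _ (Finset.mem_univ i)]
        gcongr with i' _
        exact hterm k i'
      have h2 : -N ≤ ∑ i' ∈ Finset.univ.erase i, -B₀ := by
        have : ∑ i' ∈ Finset.univ.erase i, B₀ ≤ N :=
          Finset.sum_le_sum_of_subset_of_nonneg (Finset.erase_subset _ _) fun _ _ _ => hB₀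
        rw [Finset.sum_neg_distrib]
        linarith
      rw [(cvec_eq_zero_or_one k i).resolve_left hk, one_mul] at h1
      linarith [hle k]
    have hY : |x.2.2 i| ≤ Y := abs_le.2 ⟨by simp only [Y]; linarith [hy i, abs_nonneg C], by
      simp only [Y]; linarith⟩
    refine ⟨?_, hY.trans ((le_max_left _ _).trans (le_max_right _ _))⟩
    rw [abs_of_pos (hlow x hx hA i).1]
    refine (((mem_feasible_iff_reqP P x).1 hx).2.2.2.2 i).trans ?_
    exact (Real.exp_le_exp.2 ((le_abs_self _).trans hY)).trans
      ((le_max_right _ _).trans (le_max_right _ _))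

variable {P} in
theorem IsSCARun.exists_output (hK : 0 < K) {Z : ℕ → ConvVar M K} (hZ : IsSCARun P Z)
    (hpos : ∀ t m k, 0 ≤ (Z t).1.1 m k) :
    ∃ x : Var M K, IsSCAOutput P x ∧
      Tendsto (fun t => obj P (Z t).1) atTop (𝓝 (obj P x)) ∧
      ∃ φ : ℕ → ℕ, StrictMono φ ∧ Tendsto (fun j => (Z (φ j)).1.1) atTop (𝓝 x.1) ∧
        ∀ i, (∃ k : Fin K, cvec k i ≠ 0) →
          Tendsto (fun j => (Z (φ j)).1.2.1 i) atTop (𝓝 (x.2.1 i)) ∧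
          Tendsto (fun j => (Z (φ j)).1.2.2 i) atTop (𝓝 (x.2.2 i)) := by
  classical
  obtain ⟨B, hB⟩ := exists_bound_of_obj_le P hK (obj P (Z (0 + 1)).1)
  have hB := fun t => hB (Z (t + 1)).1 (hZ.mem_feasible t) (hpos _) (hZ.antitone (Nat.zero_le t))
  have hB0 : 0 ≤ B := (norm_nonneg _).trans (hB 0).1
  -- The coordinate that does not enter the objective may be unbounded; zeroing it makes the
  -- sequence bounded.
  let cut : Vec2 K → Vec2 K := fun p i => if ∃ k : Fin K, cvec k i ≠ 0 then p i else 0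
  have hcut : ∀ p : Vec2 K, (∀ i, (∃ k : Fin K, cvec k i ≠ 0) → |p i| ≤ B) → ‖cut p‖ ≤ B := by
    refine fun p hp => (pi_norm_le_iff_of_nonneg hB0).2 fun i => ?_
    simp only [cut]
    split_ifs with h
    · exact hp i h
    · simpa using hB0
  let W : ℕ → Var M K := fun t =>
    ((Z (t + 1)).1.1, cut (Z (t + 1)).1.2.1, cut (Z (t + 1)).1.2.2)
  have hW : ∀ t, W t ∈ Metric.closedBall (0 : Var M K) B := fun t => by
    rw [mem_closedBall_zero_iff]
    exact max_le (hB t).1 (max_le (hcut _ fun i hi => ((hB t).2 i hi).1)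
      (hcut _ fun i hi => ((hB t).2 i hi).2))
  obtain ⟨w, -, ψ, hψ, hlim⟩ := tendsto_subseq_of_bounded Metric.isBounded_closedBall hW
  have hA : Tendsto (fun j => (Z (ψ j + 1)).1.1) atTop (𝓝 w.1) :=
    Tendsto.comp (f := W ∘ ψ) (continuous_fst.tendsto w) hlim
  have hp : ∀ i, (∃ k : Fin K, cvec k i ≠ 0) →
      Tendsto (fun j => (Z (ψ j + 1)).1.2.1 i) atTop (𝓝 (w.2.1 i)) := fun i hi => by
    have := ((by fun_prop : Continuous fun z : Var M K => z.2.1 i).tendsto w).comp hlim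
    refine this.congr fun j => ?_
    simp only [Function.comp_apply, W, cut]
    rw [if_pos hi]
  have hy : ∀ i, (∃ k : Fin K, cvec k i ≠ 0) →
      Tendsto (fun j => (Z (ψ j + 1)).1.2.2 i) atTop (𝓝 (w.2.2 i)) := fun i hi => by
    have := ((by fun_prop : Continuous fun z : Var M K => z.2.2 i).tendsto w).comp hlim
    refine this.congr fun j => ?_
    simp only [Function.comp_apply, W, cut]
    rw [if_pos hi]
  have hw0 : ∀ m k, 0 ≤ w.1 m k := fun m k =>
    ge_of_tendsto' (tendsto_pi_nhds.1 (tendsto_pi_nhds.1 hA m) k) fun j => hpos _ _ _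
  have hwD := mem_selDom_of_nonneg P hw0
  -- Coordinates that do not enter the objective are reset to feasible values.
  let u : Vec2 K := fun i => max (reqP P (g P w.1) i) 1
  let x : Var M K := (w.1,
    fun i => if ∃ k : Fin K, cvec k i ≠ 0 then w.2.1 i else u i,
    fun i => if ∃ k : Fin K, cvec k i ≠ 0 then w.2.2 i else Real.log (u i))
  have hxp : ∀ i, (∃ k : Fin K, cvec k i ≠ 0) → x.2.1 i = w.2.1 i := fun i hi => if_pos hi
  have hxy : ∀ i, (∃ k : Fin K, cvec k i ≠ 0) → x.2.2 i = w.2.2 i := fun i hi => if_pos hi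
  have hxp' : ∀ i, ¬(∃ k : Fin K, cvec k i ≠ 0) → x.2.1 i = u i := fun i hi => if_neg hi
  have hxy' : ∀ i, ¬(∃ k : Fin K, cvec k i ≠ 0) → x.2.2 i = Real.log (u i) :=
    fun i hi => if_neg hi
  have hmem := fun j => (mem_feasible_iff_reqP P _).1 (hZ.mem_feasible (ψ j))
  have hsel := (isClosed_selOK P).mem_of_tendsto hA
    (Eventually.of_forall fun j => ⟨(hmem j).2.1, (hmem j).2.2.1⟩)
  have hx : x ∈ feasible P := by
    refine (mem_feasible_iff_reqP P x).2 ⟨hwD, hsel.1, hsel.2, fun i => ?_, fun i => ?_⟩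
    · by_cases hi : ∃ k : Fin K, cvec k i ≠ 0
      · rw [hxp i hi]
        exact le_of_tendsto_of_tendsto' (tendsto_reqP_g P hwD hA i) (hp i hi)
          fun j => (hmem j).2.2.2.1 i
      · rw [hxp' i hi]
        exact le_max_left _ _
    · by_cases hi : ∃ k : Fin K, cvec k i ≠ 0
      · rw [hxp i hi, hxy i hi]
        exact le_of_tendsto_of_tendsto' (hp i hi) ((Real.continuous_exp.tendsto _).comp (hy i hi))
          fun j => (hmem j).2.2.2.2 i
      · rw [hxp' i hi, hxy' i hi, Real.exp_log (lt_max_of_lt_right one_pos)]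
  have hφ : StrictMono fun j => ψ j + 1 := fun a b hab => Nat.add_lt_add_right (hψ hab) 1
  have hy' : ∀ i, (∃ k : Fin K, cvec k i ≠ 0) →
      Tendsto (fun j => (Z (ψ j + 1)).1.2.2 i) atTop (𝓝 (x.2.2 i)) := fun i hi => by
    rw [hxy i hi]
    exact hy i hi
  -- Because of the reset coordinate, x need not be a limit point of the run; it is an output as a
  -- fixed point of the convexified problem.
  refine ⟨x, ⟨hwD, Or.inl ((isConvSolution_iff P _ _ _).2 ⟨mem_innerSet_self P hx,
    hZ.isMinOn hK hwD hφ hA hy'⟩)⟩, hZ.tendsto_obj hK hφ hA hy', _, hφ, hA,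
    fun i hi => ⟨?_, hy' i hi⟩⟩
  rw [hxp i hi]
  exact hp i hi

end UAVAFL

theorem proposition4 {M K : ℕ} (hM : 0 < M) (hK : 0 < K) (P : UAVAFL.Params M K) :
    -- the convexified problem is solvable at every expansion point that allows a feasible selection
    (∀ (At : UAVAFL.Sel M K) (yt : UAVAFL.Vec2 K), At ∈ UAVAFL.selDom P →
      (∃ A : UAVAFL.Sel M K, UAVAFL.StaleOK P A ∧ UAVAFL.ActiveOK P A) →
      ∃ z, UAVAFL.IsConvSolution P At yt z) ∧
    -- the value of every solution in the domain upper-bounds the device-selection problem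
    (∀ (At : UAVAFL.Sel M K) (yt : UAVAFL.Vec2 K) (z : UAVAFL.ConvVar M K),
      At ∈ UAVAFL.selDom P → UAVAFL.IsConvSolution P At yt z → z.1.1 ∈ UAVAFL.selDom P →
      z.1 ∈ UAVAFL.feasible P ∧ UAVAFL.optVal P ≤ ((UAVAFL.obj P z.1 : ℝ) : EReal)) ∧
    -- the points that the iteration yields
    (∀ x : UAVAFL.Var M K, UAVAFL.IsSCAOutput P x →
      UAVAFL.IsKKT P x ∧
      UAVAFL.optVal P ≤ ((UAVAFL.obj P x : ℝ) : EReal) ∧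
      (x ∈ UAVAFL.innerSet P x.1 x.2.2 ∧
        IsMinOn (UAVAFL.obj P) (UAVAFL.innerSet P x.1 x.2.2) x) ∧
      (x ∈ interior (UAVAFL.feasible P) ∨ x ∈ interior (UAVAFL.innerSet P x.1 x.2.2) →
        IsLocalMinOn (UAVAFL.obj P) (UAVAFL.feasible P) x)) ∧
    -- runs with nonnegative selections do approach such a point
    (∀ Z : ℕ → UAVAFL.ConvVar M K, UAVAFL.IsSCARun P Z →
      (∀ t m k, 0 ≤ (Z t).1.1 m k) →
      ∃ x : UAVAFL.Var M K, UAVAFL.IsSCAOutput P x ∧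
        Tendsto (fun t => UAVAFL.obj P (Z t).1) atTop (𝓝 (UAVAFL.obj P x)) ∧
        ∃ φ : ℕ → ℕ, StrictMono φ ∧
          Tendsto (fun j => (Z (φ j)).1.1) atTop (𝓝 x.1) ∧
          ∀ i, (∃ k, UAVAFL.cvec k i ≠ 0) →
            Tendsto (fun j => (Z (φ j)).1.2.1 i) atTop (𝓝 (x.2.1 i)) ∧
            Tendsto (fun j => (Z (φ j)).1.2.2 i) atTop (𝓝 (x.2.2 i))) := by
  refine ⟨fun At yt hAt hA => UAVAFL.exists_isConvSolution P hK hAt yt hA,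
    fun At yt z hAt hz hD => ?_, fun x hx => ?_, fun Z hZ hpos => hZ.exists_output hK hpos⟩
  · have hfeas := hz.mem_feasible P hAt hD
    exact ⟨hfeas, UAVAFL.optVal_le P hfeas⟩
  · obtain ⟨hfeas, hmin⟩ := hx.feasible_and_isMinOn hK
    exact ⟨UAVAFL.isKKT_of_isMinOn P hK hfeas hmin, UAVAFL.optVal_le P hfeas,
      ⟨UAVAFL.mem_innerSet_self P hfeas, hmin⟩,
      UAVAFL.isLocalMinOn_of_mem_interior P hK hfeas hmin⟩
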